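/- \textbf{Setting.} Let $G$ be an orientable ribbon graph with $n$ vertices and $L$ internal lines: each vertex has four corners $1,2,3,4$ in cyclic order, with signs $(-1)^{i+1}$; each internal line joins a $-$ corner to a $+$ corner, each corner carries at most one line, and the corners without a line carry external half-lines. For a line $\ell$ hooked to a vertex $V$ at corner $i$ put $\eta^V_{\ell i}=1$, $\varepsilon^V_{\ell i}=(-1)^{i+1}$ (both are $0$ otherwise), and let $\omega(i,j)=1,-1,0$ for $i<j$, $i>j$, $i=j$. Fix a root vertex $\bar V$ and $s>0$. Let $B=\begin{pmatrix} sE & C\\ -C^t&0\end{pmatrix}$, indexed by short variables $u_\ell$, long variables $v_\ell$ and hypermomenta $p_V$, $V\neq\bar V$, where $E^{uu}_{\ell\ell'}=\sum_V\sum_{i,j}(-1)^{i+j+1}\omega(i,j)\varepsilon^V_{\ell i}\varepsilon^V_{\ell' j}$, $E^{uv}$ and $E^{vv}$ are given by the same formula with $\varepsilon\eta$ and $\eta\eta$, $E^{vu}=-(E^{uv})^t$, and $C_{u_\ell V}=\sum_i(-1)^{i+1}\varepsilon^V_{\ell i}$, $C_{v_\ell V}=\sum_i(-1)^{i+1}\eta^V_{\ell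 i}$. Let $A=\mathrm{diag}(1/t_\ell,\,t_\ell,\,0)$, and $$HU(t)=\det(A+B)\prod_{\ell}t_\ell .$$ Let $B'$ be $B$ at $s=1$, let $n_{I,J}$ be the Pfaffian (defined up to sign) of $B'$ with the rows and columns $u_\ell$, $\ell\in I$, and $v_\ell$, $\ell\in J$, deleted, let $F$ be the number of faces of $G$, $2-2g=n-L+F$, and $k_{I,J}=|I|+|J|-L-F+1$. For a spanning tree $T$ of $G$, contracting $T$ gives a rosette, i.e. one vertex with the loop lines (those not in $T$) hooked to it, whose half-lines are linearly ordered starting at corner $1$ of $\bar V$. Two loop lines cross if their ends alternate; $a$ encompasses $b$ if both ends of $b$ lie between the ends of $a$. A genus line of a rosette is a line that is part of a nice crossing, i.e. of a pair of distinct lines such that the end point of the first is the successor (among the half-lines of the rosette) of the starting point of the second. \textbf{Theorem.} (1) For all $t\in(0,\infty)^L$, $$HU(t)=\sum_{I,J}s^{2g-k_{I,J}}\,n_{I,J}^2\prod_{\ell\notin I}t_\ell\prod_{\ell\in J}t_\ell .$$ (2) Let $T$ be a spanning tree of $G$, let $\tilde\ell,\ell_2\notin T$, and suppose that in the rosette of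 $T$ the line $\ell_2$ either crosses or encompasses $\tilde\ell$. Let $J_0$ be pseudo-admissible, i.e. the complement of $T\cup\{\ell_2\}$, and let $I_0$ be the set of all lines except $\tilde\ell$. Then $$n_{I_0,J_0}^2=\begin{cases}4&\text{if }\tilde\ell\text{ is a genus line},\\ 16&\text{if }\tilde\ell\text{ is not a genus line,}\end{cases}$$ where ``genus line'' refers to the rosette formed by the two loop lines $\tilde\ell,\ell_2$ that remain when the other lines of $J_0$ are removed and $T$ is contracted; equivalently, the value is $4$ if $\ell_2$ crosses $\tilde\ell$ and $16$ if $\ell_2$ encompasses $\tilde\ell$. Moreover $|I_0|=L-1$, $|J_0|=F-2+2g$ and $2g-k_{I_0,J_0}=2$. (3) Let $S$ be a set of lines of $G$, viewed as a subgraph with the $n(S)$ vertices that its $L(S)$ lines touch, and let $T$ be a spanning tree of $G$ such that $T\cap S$ is a spanning tree of $S$. Suppose that $S$ is planar with more than one broken face (face containing an external half-line of $S$), and that a line $\tilde\ell\notin S\cup T$ of $G$ breaks an internal face of $S$, i.e. has an end $c$ at a corner of a vertex of $S$ on a face of $S$ other than the external one; the external face is the face of $S$ met first when walking around $T$ from corner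 $1$ of $\bar V$. Then: (a) there is a line $\ell_2\in S\setminus T$ with $c$ between its two ends in the rosette, and $\ell_2$ crosses or encompasses $\tilde\ell$; (b) for every $\ell_2\in S\setminus T$ that crosses or encompasses $\tilde\ell$, with $J_0$ and $I_0$ as in (2), one has $|J_0\cap S|=L(S)-n(S)$, and for all $t\in(0,\infty)^L$ and $\rho>0$, if $t^{(\rho)}$ denotes $t$ with $t_\ell$ replaced by $\rho^2t_\ell$ for $\ell\in S$, $$HU(t^{(\rho)})\ \ge\ s^2\,n_{I_0,J_0}^2\;t_{\tilde\ell}\prod_{\ell\in J_0}t_\ell\;\rho^{2(L(S)-n(S))};$$ (c) $S$ is convergent: there is $\delta>0$ such that $\int_0^1\rho^{2L(S)-1}\,HU(t^{(\rho)})^{-D/2}\,d\rho$ converges absolutely for all $t\in(0,\infty)^L$ and all $D\in\mathbb C$ with $0<\mathrm{Re}\,D<4+\delta$. -/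

import Mathlib

/-- An orientable ribbon graph of the noncommutative quartic model.  Every vertex has four corners,
numbered `0,1,2,3` in cyclic order (the usual labels `1,2,3,4` shifted by one); the even corners carry
the sign `+`, the odd ones the sign `-`.  Every internal line joins a `-` corner (its tail) to a `+`
corner (its head), and a corner meets at most one line.  Corners which meet no line carry external
half-lines. -/
structure NCGraph (V L : Type*) where
  head : L → V × Fin 4
  tail : L → V × Fin 4
  head_injective : Function.Injective head
  tail_injective : Function.Injective tail
  head_even : ∀ l, Even ((head l).2 : ℕ)
  tail_odd : ∀ l, Odd ((tail l).2 : ℕ)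

/-- The Pfaffian of a `2m × 2m` matrix,
`(1 / (2^m m!)) ∑_σ sgn σ ∏_{i<m} A (σ (2i)) (σ (2i+1))`; it is `0` in odd size. -/
noncomputable def finPfaffian {N : ℕ} (A : Matrix (Fin N) (Fin N) ℚ) : ℚ :=
  if Even N then
    (∑ σ : Equiv.Perm (Fin N), ((Equiv.Perm.sign σ : ℤ) : ℚ) *
      ∏ i : Fin (N / 2), A (σ ⟨2 * i, by omega⟩) (σ ⟨2 * i + 1, by omega⟩)) /
      (2 ^ (N / 2) * (Nat.factorial (N / 2) : ℚ))
  else 0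

/-- The Pfaffian of a matrix indexed by a finite type, for a fixed enumeration of the index type
(another enumeration changes at most the sign). -/
noncomputable def pfaffian {ι : Type*} [Fintype ι] (A : Matrix ι ι ℚ) : ℚ :=
  finPfaffian (A.submatrix (Fintype.equivFin ι).symm (Fintype.equivFin ι).symm)

/-- The antisymmetric sign `ω(i,j)`. -/
def omegaSign (i j : Fin 4) : ℤ := if i < j then 1 else if j < i then -1 else 0

namespace NCGraph

variable {V L : Type*} [Fintype V] [DecidableEq V] [Fintype L] [DecidableEq L]

section Matrices

/-- `η`: does the line `l` hook to the vertex `v` at the corner `i`? -/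
def eta (G : NCGraph V L) (v : V) (l : L) (i : Fin 4) : ℤ :=
  if G.head l = (v, i) ∨ G.tail l = (v, i) then 1 else 0

/-- The incidence matrix `ε`; with corners numbered from `0` the sign is `(-1)^i`. -/
def eps (G : NCGraph V L) (v : V) (l : L) (i : Fin 4) : ℤ := (-1) ^ (i : ℕ) * G.eta v l i

/-- `∑_V ∑_{i,j} (-1)^(i+j+1) ω(i,j) a^V_{l i} b^V_{l' j}` (the parity of `i+j` does not depend on
whether corners are numbered from `0` or from `1`). -/
def oscillation (a b : V → L → Fin 4 → ℤ) (l l' : L) : ℤ :=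
  ∑ v : V, ∑ i : Fin 4, ∑ j : Fin 4,
    (-1) ^ ((i : ℕ) + (j : ℕ) + 1) * omegaSign i j * a v l i * b v l' j

/-- Indices of the quadratic form: short variables `u`, long variables `v`, and the hypermomenta
of all vertices except the root. -/
abbrev Index (V L : Type*) (root : V) : Type _ := L ⊕ L ⊕ {v : V // v ≠ root}

/-- The antisymmetric matrix `B = [[s E, C], [-Cᵗ, 0]]`, with
`E = [[E^{uu}, E^{uv}], [E^{vu}, E^{vv}]]` and `E^{vu} = -(E^{uv})ᵗ`. -/
def matB {R : Type*} [Ring R] (G : NCGraph V L) (root : V) (s : R) :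
    Matrix (Index V L root) (Index V L root) R
  | .inl l, .inl l' => s * (oscillation G.eps G.eps l l' : ℤ)
  | .inl l, .inr (.inl l') => s * (oscillation G.eps G.eta l l' : ℤ)
  | .inr (.inl l), .inl l' => -(s * (oscillation G.eps G.eta l' l : ℤ))
  | .inr (.inl l), .inr (.inl l') => s * (oscillation G.eta G.eta l l' : ℤ)
  | .inl l, .inr (.inr v) => ((∑ i : Fin 4, (-1) ^ (i : ℕ) * G.eps v l i : ℤ) : R)
  | .inr (.inl l), .inr (.inr v) => ((∑ i : Fin 4, (-1) ^ (i : ℕ) * G.eta v l i : ℤ) : R)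
  | .inr (.inr v), .inl l => -((∑ i : Fin 4, (-1) ^ (i : ℕ) * G.eps v l i : ℤ) : R)
  | .inr (.inr v), .inr (.inl l) => -((∑ i : Fin 4, (-1) ^ (i : ℕ) * G.eta v l i : ℤ) : R)
  | .inr (.inr _), .inr (.inr _) => 0

/-- The diagonal matrix `A`, with entries `c_l = 1 / t_l`, `t_l` and `0`. -/
noncomputable def matA (root : V) (t : L → ℝ) : Matrix (Index V L root) (Index V L root) ℝ :=
  Matrix.diagonal (Sum.elim (fun l => (t l)⁻¹) (Sum.elim t (fun _ => 0)))

/-- The first hyperbolic polynomial `HU = det (A + B) ∏ t_l`, as a function of nonzero `t`. -/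
noncomputable def HU (G : NCGraph V L) (root : V) (s : ℝ) (t : L → ℝ) : ℝ :=
  (matA root t + G.matB root s).det * ∏ l, t l

/-- The indices that remain when the short variables of `I` and the long variables of `J`
are deleted. -/
def Kept (root : V) (I J : Finset L) : Index V L root → Prop
  | .inl l => l ∉ I
  | .inr (.inl l) => l ∉ J
  | .inr (.inr _) => True

open Classical in
/-- `n_{I,J}`: the Pfaffian of the integer matrix `B'` (`B` at `s = 1`) with the rows and columns
`I` (short) and `J` (long) deleted. -/
noncomputable def nPf (G : NCGraph V L) (root : V) (I J : Finset L) : ℚ :=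
  pfaffian (ι := {x : Index V L root // Kept root I J x})
    ((G.matB root (1 : ℚ)).submatrix Subtype.val Subtype.val)

end Matrices

section Topology

/-- The corner `h` is an end of the line `l`. -/
def IsEnd (G : NCGraph V L) (l : L) (h : V × Fin 4) : Prop := h = G.head l ∨ h = G.tail l

theorem head_ne_tail (G : NCGraph V L) (l l' : L) : G.head l ≠ G.tail l' := by
  intro h
  have h1 := G.head_even l
  have h2 := G.tail_odd l'
  rw [h] at h1
  exact (Nat.not_even_iff_odd.mpr h2) h1

open Classical in
/-- The corner at the other end of the line of `S` at the corner `h`; `h` itself if no line of `S`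
ends there. -/
noncomputable def otherEnd (G : NCGraph V L) (S : Finset L) (h : V × Fin 4) : V × Fin 4 :=
  if e : ∃ l ∈ S, G.head l = h then G.tail e.choose
  else if e : ∃ l ∈ S, G.tail l = h then G.head e.choose
  else h

theorem otherEnd_head (G : NCGraph V L) {S : Finset L} {l : L} (hl : l ∈ S) :
    G.otherEnd S (G.head l) = G.tail l := by
  have e : ∃ l' ∈ S, G.head l' = G.head l := ⟨l, hl, rfl⟩
  rw [otherEnd, dif_pos e, G.head_injective e.choose_spec.2]

theorem otherEnd_tail (G : NCGraph V L) {S : Finset L} {l : L} (hl : l ∈ S) :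
    G.otherEnd S (G.tail l) = G.head l := by
  have e0 : ¬ ∃ l' ∈ S, G.head l' = G.tail l := fun ⟨l', _, h⟩ => G.head_ne_tail l' l h
  have e : ∃ l' ∈ S, G.tail l' = G.tail l := ⟨l, hl, rfl⟩
  rw [otherEnd, dif_neg e0, dif_pos e, G.tail_injective e.choose_spec.2]

theorem otherEnd_involutive (G : NCGraph V L) (S : Finset L) :
    Function.Involutive (G.otherEnd S) := by
  intro h
  by_cases e : ∃ l ∈ S, G.head l = h
  · obtain ⟨l, hl, rfl⟩ := e
    rw [otherEnd_head G hl, otherEnd_tail G hl]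
  · by_cases e' : ∃ l ∈ S, G.tail l = h
    · obtain ⟨l, hl, rfl⟩ := e'
      rw [otherEnd_tail G hl, otherEnd_head G hl]
    · have : G.otherEnd S h = h := by rw [otherEnd, dif_neg e, dif_neg e']
      rw [this, this]

/-- Walking along the faces of the ribbon graph whose lines are those of `S`: follow the line of `S`
at the corner (if there is one), then go to the next corner of the vertex that is reached.  The
corner `h` stands for the piece of face which runs between the preceding corner and `h`. -/
noncomputable def faceStep (G : NCGraph V L) (S : Finset L) : Equiv.Perm (V × Fin 4) :=
  ((G.otherEnd_involutive S).toPerm (G.otherEnd S)).trans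
    ((Equiv.refl V).prodCongr (Equiv.addRight (1 : Fin 4)))

/-- The vertices of the subgraph formed by the lines of `S`. -/
def verts (G : NCGraph V L) (S : Finset L) : Finset V :=
  S.image (fun l => (G.head l).1) ∪ S.image (fun l => (G.tail l).1)

open Classical in
/-- The face through the corner `h`. -/
noncomputable def face (G : NCGraph V L) (S : Finset L) (h : V × Fin 4) : Finset (V × Fin 4) :=
  Finset.univ.filter (fun h' => (G.faceStep S).SameCycle h h')

/-- The faces of the ribbon graph with vertices `W` and lines `S`. -/
noncomputable def faces (G : NCGraph V L) (W : Finset V) (S : Finset L) :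
    Finset (Finset (V × Fin 4)) :=
  (W ×ˢ (Finset.univ : Finset (Fin 4))).image (G.face S)

open Classical in
/-- The broken faces: those which contain an external half-line of the subgraph. -/
noncomputable def brokenFaces (G : NCGraph V L) (W : Finset V) (S : Finset L) :
    Finset (Finset (V × Fin 4)) :=
  (G.faces W S).filter (fun f => ∃ h ∈ f, ∀ l ∈ S, ¬ G.IsEnd l h)

/-- `2g`, from `2 - 2g = n - L + F`. -/
noncomputable def twoGenus (G : NCGraph V L) (W : Finset V) (S : Finset L) : ℤ :=
  2 - ((W.card : ℤ) - S.card + (G.faces W S).card)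

/-- `k_{I,J} = |I| + |J| - L - F + 1`. -/
noncomputable def kIndex (G : NCGraph V L) (I J : Finset L) : ℤ :=
  (I.card : ℤ) + J.card - Fintype.card L - (G.faces Finset.univ Finset.univ).card + 1

/-- Two vertices are joined by a line of `T`. -/
def Joined (G : NCGraph V L) (T : Finset L) (v w : V) : Prop :=
  ∃ l ∈ T, ((G.head l).1 = v ∧ (G.tail l).1 = w) ∨ ((G.head l).1 = w ∧ (G.tail l).1 = v)

/-- The lines of `T` form a tree with vertex set `W`: they have their ends in `W`, they connect `W`,
and there are `|W| - 1` of them. -/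
def IsTreeOn (G : NCGraph V L) (T : Finset L) (W : Finset V) : Prop :=
  T.card + 1 = W.card ∧ G.verts T ⊆ W ∧
    ∀ v ∈ W, ∀ w ∈ W, Relation.ReflTransGen (G.Joined T) v w

/-- The position of a corner in the rooted rosette.  Contracting the lines of a spanning tree `T`
merges all vertices into one; the corners are then met in the order in which one meets them when
walking around `T`, starting from corner `0` of the root. -/
noncomputable def pos (G : NCGraph V L) (root : V) (T : Finset L) (h : V × Fin 4) : ℕ :=
  sInf {k : ℕ | ((G.faceStep T) ^ k) (root, 0) = h}

/-- The position of the first end of `l` in the rosette. -/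
noncomputable def start (G : NCGraph V L) (root : V) (T : Finset L) (l : L) : ℕ :=
  min (G.pos root T (G.head l)) (G.pos root T (G.tail l))

/-- The position of the last end of `l` in the rosette. -/
noncomputable def finish (G : NCGraph V L) (root : V) (T : Finset L) (l : L) : ℕ :=
  max (G.pos root T (G.head l)) (G.pos root T (G.tail l))

/-- The loop lines `a` and `b` cross in the rosette. -/
def Crosses (G : NCGraph V L) (root : V) (T : Finset L) (a b : L) : Prop :=
  (G.start root T a < G.start root T b ∧ G.start root T b < G.finish root T a ∧
      G.finish root T a < G.finish root T b) ∨
    (G.start root T b < G.start root T a ∧ G.start root T a < G.finish root T b ∧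
      G.finish root T b < G.finish root T a)

/-- The loop line `a` encompasses the loop line `b` in the rosette. -/
def Encompasses (G : NCGraph V L) (root : V) (T : Finset L) (a b : L) : Prop :=
  G.start root T a < G.start root T b ∧ G.finish root T b < G.finish root T a

/-- In the rosette carrying only the loop lines `M`, the lines `a` and `b` form a nice crossing: the
end point of `a` is the successor of the starting point of `b` among the half-lines of `M`. -/
def NiceCrossing (G : NCGraph V L) (root : V) (T M : Finset L) (a b : L) : Prop :=
  a ≠ b ∧ G.start root T b < G.finish root T a ∧
    ∀ m ∈ M, ∀ h, G.IsEnd m h →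
      ¬ (G.start root T b < G.pos root T h ∧ G.pos root T h < G.finish root T a)

/-- `l` is a genus line of the rosette with tree `T` and loop lines `M`: it is part of a nice
crossing. -/
def IsGenusLine (G : NCGraph V L) (root : V) (T M : Finset L) (l : L) : Prop :=
  ∃ l' ∈ M, G.NiceCrossing root T M l l' ∨ G.NiceCrossing root T M l' l

/-- `J` is pseudo-admissible: its complement is the union of the spanning tree `T` and of `l₂`, and
neither `lt` nor `l₂` belongs to `T`. -/
def IsPseudoAdmissible (G : NCGraph V L) (T : Finset L) (lt l₂ : L) (J : Finset L) : Prop :=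
  G.IsTreeOn T Finset.univ ∧ Jᶜ = insert l₂ T ∧ lt ∉ T ∧ l₂ ∉ T

/-- The corner `h` lies on the external face of the subgraph `S`.  This is the face of `S` which one
meets first when walking around the tree `T` from the root: the face that faces the root of the
rosette. -/
def OnExternalFace (G : NCGraph V L) (root : V) (T S : Finset L) (h : V × Fin 4) : Prop :=
  ∃ h₀, h₀.1 ∈ G.verts S ∧ (∀ h', h'.1 ∈ G.verts S → G.pos root T h₀ ≤ G.pos root T h') ∧
    h ∈ G.face S h₀

/-- The line `lt`, not in `S`, hooks to `S` at the corner `h` and breaks there an internal face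
of `S`. -/
def BreaksInternalFaceAt (G : NCGraph V L) (root : V) (T S : Finset L) (lt : L)
    (h : V × Fin 4) : Prop :=
  lt ∉ S ∧ G.IsEnd lt h ∧ h.1 ∈ G.verts S ∧ ¬ G.OnExternalFace root T S h

end Topology

/-- Rescaling by `ρ²` of the parameters of the lines of `S`. -/
def rescale (S : Finset L) (ρ : ℝ) (t : L → ℝ) (l : L) : ℝ := if l ∈ S then ρ ^ 2 * t l else t l

end NCGraph

/-! The square of the Pfaffian of a skew matrix is its determinant (`pfaffian_sq`), so every
coefficient of the expansion is a minor of `B`. Since `A` is diagonal and vanishes on the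
hypermomenta, `det_diagonal_add` expands `HU` over the deleted short and long variables, and
rescaling rows and columns extracts the power of `s` (`det_keptB`). All terms are nonnegative, so
each one alone bounds `HU` from below.

For the value of the Pfaffian, the surviving indices are one short variable (of `lt`), one long
variable (of `l₂`), the long variables of the tree and the hypermomenta. The block on the last two
families is bordered by the reduced incidence matrix of a spanning tree, which is invertible over
the integers; the minor is therefore, up to sign, the square of one entry of a 2 × 2 Schur
complement. That entry requires solving a linear system, and the solution is read off from a
potential: the signed indicator of the stretch between the two ends of `l₂` on the walk around `T`.
Around each vertex the variation of this potential is the long variable of `l₂` plus tree long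
variables, and the oscillation form evaluated on a variation telescopes (`cornerForm_potential`,
`cornerForm_reduction`). The entry is twice the sum of the potential at the two ends of `lt`: ±2 if
exactly one of them lies between the ends of `l₂`, ±4 if both do.

For the subgraph `S`, the indicator of the stretch from the first corner of `S` to `c` is used in
the same way. If no loop line of `S` covers `c`, this indicator varies along the faces of `S` only
at those two corners, so they share a face and `c` is on the external one
(`mem_face_of_not_covered`). Hence a broken internal face yields a covering loop line `l₂`, and the
corresponding term has positive coefficient and degree `2(L(S) - n(S))` in `ρ`. As `c` is a corner
free of lines of `S`, `2 L(S) < 4 n(S)`, which leaves room above dimension four. -/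

set_option linter.unusedSectionVars false

/-! ### Pfaffians: the square is the determinant. -/

section PfaffianSquare

open Matrix Equiv Finset

/-- The signed sum over pairings which, up to normalisation, is the Pfaffian; the index set is already
grouped into pairs. -/
noncomputable def pairingSum {κ : Type*} [Fintype κ] [DecidableEq κ]
    (A : Matrix (κ × Fin 2) (κ × Fin 2) ℚ) : ℚ :=
  ∑ σ : Perm (κ × Fin 2), ((Perm.sign σ : ℤ) : ℚ) * ∏ k, A (σ (k, 0)) (σ (k, 1))

/-- The standard symplectic matrix. -/
def symplecticForm (κ : Type*) [DecidableEq κ] : Matrix (κ × Fin 2) (κ × Fin 2) ℚ :=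
  fun x y => if x.1 = y.1 then !![0, 1; -1, 0] x.2 y.2 else 0

variable {κ : Type*} [Fintype κ] [DecidableEq κ]

theorem det_submatrix_id_of_not_bijective {ι : Type*} [Fintype ι] [DecidableEq ι]
    (P : Matrix ι ι ℚ) {g : ι → ι} (hg : ¬ Function.Bijective g) : (P.submatrix id g).det = 0 := by
  rw [← Finite.injective_iff_bijective, Function.Injective] at hg
  push Not at hg
  obtain ⟨i, j, hij, hne⟩ := hg
  exact det_zero_of_column_eq hne (fun k => by simp [hij])

theorem congr_apply_eq_sum {ι : Type*} [Fintype ι] (P A : Matrix ι ι ℚ) (a b : ι) :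
    (P * A * Pᵀ) a b = ∑ w : Fin 2 → ι, A (w 0) (w 1) * (P a (w 0) * P b (w 1)) := by
  rw [← (finTwoArrowEquiv ι).symm.sum_comp, Fintype.sum_prod_type, Finset.sum_comm]
  simp only [mul_apply, transpose_apply, finTwoArrowEquiv_symm_apply, cons_val_zero, cons_val_one,
    Finset.sum_mul]
  exact Finset.sum_congr rfl fun _ _ => Finset.sum_congr rfl fun _ _ => by ring

/-- Expanding every entry of the congruent matrix and summing over `σ` first leaves, for each map
`g`, the determinant of `P` with columns chosen by `g`. A non-bijective `g` repeats a column and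
drops out; a permutation gives `sign g * det P`. -/
theorem pairingSum_congr (P A : Matrix (κ × Fin 2) (κ × Fin 2) ℚ) :
    pairingSum (P * A * Pᵀ) = P.det * pairingSum A := by
  have expand : ∀ σ : Perm (κ × Fin 2), ∏ k, (P * A * Pᵀ) (σ (k, 0)) (σ (k, 1)) =
      ∑ g : κ × Fin 2 → κ × Fin 2, (∏ k, A (g (k, 0)) (g (k, 1))) * ∏ x, P (σ x) (g x) := by
    intro σ
    simp only [congr_apply_eq_sum]
    rw [Finset.prod_univ_sum, Fintype.piFinset_univ, ← (Equiv.curry κ (Fin 2) (κ × Fin 2)).sum_comp]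
    refine Finset.sum_congr rfl fun g _ => ?_
    rw [Finset.prod_mul_distrib, Fintype.prod_prod_type]
    simp [Fin.prod_univ_two]
  have key : pairingSum (P * A * Pᵀ) = ∑ g : κ × Fin 2 → κ × Fin 2,
      (∏ k, A (g (k, 0)) (g (k, 1))) * (P.submatrix id g).det := by
    simp only [pairingSum, expand, det_apply', submatrix_apply, id, Finset.mul_sum]
    rw [Finset.sum_comm]
    exact Finset.sum_congr rfl fun _ _ => Finset.sum_congr rfl fun _ _ => by ring
  rw [key, pairingSum, Finset.mul_sum]
  symm
  refine Finset.sum_of_injOn (fun σ : Perm (κ × Fin 2) => (σ : κ × Fin 2 → κ × Fin 2))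
    (fun _ _ _ _ h => DFunLike.coe_injective h) (fun _ _ => by simp) ?_ ?_
  · intro g _ hg
    rw [det_submatrix_id_of_not_bijective, mul_zero]
    intro hb
    exact hg ⟨Equiv.ofBijective g hb, by simp, rfl⟩
  · intro σ _
    have := det_permute' σ P
    rw [this]
    ring

theorem symplecticForm_eq_reindex :
    symplecticForm κ = (blockDiagonal fun _ : κ => !![(0 : ℚ), 1; -1, 0]).submatrix
      (Equiv.prodComm κ (Fin 2)) (Equiv.prodComm κ (Fin 2)) := by
  ext ⟨k, a⟩ ⟨k', b⟩
  simp [symplecticForm, blockDiagonal_apply]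

theorem det_symplecticForm : (symplecticForm κ).det = 1 := by
  rw [symplecticForm_eq_reindex, det_submatrix_equiv_self, det_blockDiagonal]
  simp [det_fin_two]

/-- The permutation `(k, a) ↦ (π k, ε k a)`. -/
def pairPerm (p : Perm κ × (κ → Perm (Fin 2))) : Perm (κ × Fin 2) :=
  (prodCongrRight p.2).trans (prodCongrLeft fun _ => p.1)

theorem pairPerm_injective : Function.Injective (pairPerm (κ := κ)) := by
  rintro ⟨π, ε⟩ ⟨π', ε'⟩ h
  have h' : ∀ k a, (π k, ε k a) = (π' k, ε' k a) := fun k a => by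
    simpa [pairPerm] using Equiv.congr_fun h (k, a)
  simp only [Prod.mk.injEq] at h' ⊢
  exact ⟨Equiv.ext fun k => (h' k 0).1, funext fun k => Equiv.ext fun a => (h' k a).2⟩

theorem symplectic_entry_perm (ε : Perm (Fin 2)) :
    (!![(0 : ℚ), 1; -1, 0]) (ε 0) (ε 1) = ((Perm.sign ε : ℤ) : ℚ) := by
  revert ε
  decide +kernel

/-- Permuting whole pairs is even because each pair has two elements; a swap inside a pair changes
both the sign of the permutation and one symplectic entry. -/
theorem pairPerm_term (p : Perm κ × (κ → Perm (Fin 2))) :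
    ((Perm.sign (pairPerm p) : ℤ) : ℚ) *
      ∏ k, symplecticForm κ (pairPerm p (k, 0)) (pairPerm p (k, 1)) = 1 := by
  have h1 : Perm.sign (pairPerm p) = ∏ k, Perm.sign (p.2 k) := by
    rw [pairPerm, Perm.sign_trans, Perm.sign_prodCongrRight, Perm.sign_prodCongrLeft]
    simp
  have h2 : ∀ k, symplecticForm κ (pairPerm p (k, 0)) (pairPerm p (k, 1)) =
      ((Perm.sign (p.2 k) : ℤ) : ℚ) := fun k => by
    simp [pairPerm, symplecticForm, ← symplectic_entry_perm]
  simp only [h1, h2, Units.coe_prod, Int.cast_prod, ← Finset.prod_mul_distrib]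
  refine Finset.prod_eq_one fun k _ => ?_
  rcases Int.units_eq_one_or (Perm.sign (p.2 k)) with h | h <;> simp [h]

theorem exists_pairPerm {σ : Perm (κ × Fin 2)} (hσ : ∀ k, (σ (k, 0)).1 = (σ (k, 1)).1) :
    ∃ p, pairPerm p = σ := by
  have hfst : ∀ k a, (σ (k, a)).1 = (σ (k, 0)).1 := by
    intro k a
    fin_cases a
    · rfl
    · exact (hσ k).symm
  have hsurj : Function.Surjective fun k => (σ (k, 0)).1 := fun y =>
    ⟨(σ.symm (y, 0)).1, by
      have := hfst (σ.symm (y, 0)).1 (σ.symm (y, 0)).2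
      simpa using this.symm⟩
  have hinj : ∀ k, Function.Injective fun a => (σ (k, a)).2 := fun k a b hab => by
    have : σ (k, a) = σ (k, b) := Prod.ext ((hfst k a).trans (hfst k b).symm) hab
    simpa using this
  refine ⟨⟨Equiv.ofBijective _ (Finite.surjective_iff_bijective.1 hsurj),
    fun k => Equiv.ofBijective _ (Finite.injective_iff_bijective.1 (hinj k))⟩, ?_⟩
  ext ⟨k, a⟩ : 1
  exact Prod.ext (by simp [pairPerm, hfst k a]) (by simp [pairPerm])

/-- Only permutations that send pairs to pairs contribute, each of them 1, so the sum counts them.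
-/
theorem pairingSum_symplecticForm :
    pairingSum (symplecticForm κ) = 2 ^ Fintype.card κ * (Nat.factorial (Fintype.card κ) : ℚ) := by
  have h : ∑ _p : Perm κ × (κ → Perm (Fin 2)), (1 : ℚ) = pairingSum (symplecticForm κ) := by
    refine Finset.sum_of_injOn pairPerm (pairPerm_injective.injOn) (fun _ _ => by simp) ?_
      (fun p _ => (pairPerm_term p).symm)
    intro σ _ hσ
    by_contra hne
    apply hσ
    obtain ⟨p, hp⟩ := exists_pairPerm (σ := σ) fun k => by
      by_contra hk
      apply hne
      rw [Finset.prod_eq_zero (Finset.mem_univ k) (by simp [symplecticForm, hk]), mul_zero]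
    exact ⟨p, by simp, hp⟩
  rw [← h]
  simp [Fintype.card_perm, mul_comm]

/-- A nonsingular antisymmetric matrix is congruent to the standard symplectic one. -/
theorem exists_symplectic_congr (N : ℕ) : ∀ A : Matrix (Fin N) (Fin N) ℚ, Aᵀ = -A → A.det ≠ 0 →
    ∃ (m : ℕ) (_ : Fin N ≃ Fin m × Fin 2) (P : Matrix (Fin N) (Fin m × Fin 2) ℚ),
      A = P * symplecticForm (Fin m) * Pᵀ := by
  induction N using Nat.strong_induction_on with
  | _ N ih =>
  intro A hA hdet
  rcases N with _ | N
  · exact ⟨0, Equiv.equivOfIsEmpty _ _, 0, Subsingleton.elim _ _⟩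
  have hdiag : ∀ i, A i i = 0 := fun i => by
    have := congrFun (congrFun hA i) i
    rw [transpose_apply, Matrix.neg_apply] at this
    linarith
  obtain ⟨j, hj⟩ : ∃ j, A 0 j ≠ 0 := by
    by_contra! h
    exact hdet (det_eq_zero_of_row_eq_zero 0 h)
  have hj0 : j ≠ 0 := fun h => hj (h ▸ hdiag 0)
  obtain ⟨M, rfl⟩ : ∃ M, N = M + 1 := Nat.exists_eq_succ_of_ne_zero (by
    rintro rfl
    exact hj0 (Fin.fin_one_eq_zero j))
  -- Skew Gaussian elimination: a nonzero entry of row 0 gives an invertible 2 × 2 pivot block, and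
  -- the induction continues with its Schur complement, again skew and nonsingular.
  obtain ⟨e, he0, he1⟩ : ∃ e : Fin 2 ⊕ Fin M ≃ Fin (M + 1 + 1), e (.inl 0) = 0 ∧ e (.inl 1) = j := by
    refine ⟨(finSumFinEquiv.trans (finCongr (by omega))).trans (swap 1 j), ?_, ?_⟩
    · have : (finSumFinEquiv.trans (finCongr (by omega : 2 + M = M + 1 + 1))) (.inl 0) = 0 := rfl
      rw [Equiv.trans_apply, this, swap_apply_of_ne_of_ne (by simp) hj0.symm]
    · have : (finSumFinEquiv.trans (finCongr (by omega : 2 + M = M + 1 + 1))) (.inl 1) = 1 := rfl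
      rw [Equiv.trans_apply, this, swap_apply_left]
  set X : Matrix (Fin 2) (Fin 2) ℚ := (A.submatrix e e).toBlocks₁₁ with hX
  set Y : Matrix (Fin 2) (Fin M) ℚ := (A.submatrix e e).toBlocks₁₂ with hY
  set Z : Matrix (Fin M) (Fin M) ℚ := (A.submatrix e e).toBlocks₂₂ with hZ
  have hAe : ∀ i k, A i k = - A k i := fun i k => by
    have := congrFun (congrFun hA k) i
    simpa using this
  have hblock : A.submatrix e e = fromBlocks X Y (-Yᵀ) Z := by
    rw [← fromBlocks_toBlocks (A.submatrix e e)]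
    congr 1
    ext i k
    simpa [toBlocks₂₁, hY, toBlocks₁₂] using hAe _ _
  have hXe : X = A 0 j • !![(0 : ℚ), 1; -1, 0] := by
    ext i k
    fin_cases i <;> fin_cases k <;>
      simp [hX, toBlocks₁₁, he0, he1, hdiag, hAe j 0]
  have hXdet : X.det = A 0 j ^ 2 := by
    rw [hXe, det_smul]; simp [det_fin_two]
  have : Invertible X := invertibleOfIsUnitDet X (by rw [hXdet]; exact (pow_ne_zero 2 hj).isUnit)
  have hXT : (X⁻¹)ᵀ = -X⁻¹ := by
    rw [transpose_nonsing_inv]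
    have : Xᵀ = -X := by
      rw [hXe]; ext i k; fin_cases i <;> fin_cases k <;> simp
    rw [this]
    refine inv_eq_left_inv ?_
    simp
  set S : Matrix (Fin M) (Fin M) ℚ := Z - -Yᵀ * ⅟X * Y with hS
  set Q : Matrix (Fin 2 ⊕ Fin M) (Fin 2 ⊕ Fin M) ℚ := fromBlocks 1 0 (-Yᵀ * ⅟X) 1 with hQ
  have hQT : Qᵀ = fromBlocks 1 (⅟X * Y) 0 1 := by
    rw [hQ, fromBlocks_transpose]
    simp [hXT]
  have hdec : A.submatrix e e = Q * fromBlocks X 0 0 S * Qᵀ := by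
    rw [hblock, hQT, fromBlocks_eq_of_invertible₁₁]
  have hST : Sᵀ = -S := by
    have hZT : Zᵀ = -Z := by
      ext i k
      simpa [hZ, toBlocks₂₂] using hAe _ _
    rw [hS]
    simp [hZT, hXT, Matrix.mul_assoc]
    abel
  have hSdet : S.det ≠ 0 := by
    intro h0
    apply hdet
    rw [← det_submatrix_equiv_self e A, hdec, det_mul, det_mul, det_fromBlocks_zero₂₁, h0]
    simp
  obtain ⟨m, f, R, hR⟩ := ih M (by omega) S hST hSdet
  -- Scaling one of the two pivot vectors by `A 0 j` turns the standard 2 × 2 block into the pivot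
  -- block.
  let D : Matrix (Fin 2 ⊕ Fin M) (Fin 2 ⊕ (Fin m × Fin 2)) ℚ :=
    fromBlocks (diagonal ![A 0 j, 1]) 0 0 R
  let c : Fin 2 ⊕ (Fin m × Fin 2) ≃ Fin (m + 1) × Fin 2 :=
    ((Equiv.sumCongr (Equiv.uniqueProd (Fin 2) (Fin 1)).symm (Equiv.refl _)).trans
      (Equiv.sumProdDistrib (Fin 1) (Fin m) (Fin 2)).symm).trans
      (Equiv.prodCongr (finSumFinEquiv.trans (finCongr (by omega))) (Equiv.refl _))
  have hJ : (symplecticForm (Fin (m + 1))).submatrix c c =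
      fromBlocks !![0, 1; -1, 0] 0 0 (symplecticForm (Fin m)) := by
    ext (i | i) (k | k) <;>
      simp [c, symplecticForm, Fin.ext_iff]
  have hD : fromBlocks X 0 0 S = D * (symplecticForm (Fin (m + 1))).submatrix c c * Dᵀ := by
    rw [hJ, hR, fromBlocks_transpose, fromBlocks_multiply, fromBlocks_multiply, hXe]
    simp only [Matrix.mul_zero, Matrix.zero_mul, add_zero, zero_add, transpose_zero]
    congr 1
    ext i k
    fin_cases i <;> fin_cases k <;> simp [Matrix.mul_apply, diagonal]
  refine ⟨m + 1, e.symm.trans ((Equiv.sumCongr (Equiv.refl _) f).trans c),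
    (Q * D).submatrix e.symm c.symm, ?_⟩
  have : A = (A.submatrix e e).submatrix e.symm e.symm := by simp
  rw [this, hdec, hD]
  have hc : symplecticForm (Fin (m + 1)) =
    ((symplecticForm (Fin (m + 1))).submatrix c c).submatrix c.symm c.symm := by simp
  conv_rhs => rw [hc]
  rw [transpose_submatrix, submatrix_mul_equiv, submatrix_mul_equiv, transpose_mul]
  simp only [Matrix.mul_assoc]

theorem pairingSum_eq_zero {A : Matrix (κ × Fin 2) (κ × Fin 2) ℚ} {x : κ × Fin 2}
    (hrow : ∀ y, A x y = 0) (hcol : ∀ y, A y x = 0) : pairingSum A = 0 := by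
  refine Finset.sum_eq_zero fun σ _ => ?_
  rw [Finset.prod_eq_zero (Finset.mem_univ (σ.symm x).1), mul_zero]
  have h : σ ((σ.symm x).1, (σ.symm x).2) = x := by simp
  generalize (σ.symm x).1 = k at h ⊢
  generalize (σ.symm x).2 = a at h
  fin_cases a
  · exact (congrArg (A · _) h).trans (hrow _)
  · exact (congrArg (A _) h).trans (hcol _)

/-- Under congruence by `P` both sides are multiplied by `det P ^ 2`. A nonsingular `A` thus reduces
to the symplectic form, and a singular one to a matrix with a zero row and column. -/
theorem pairingSum_sq {m : ℕ} (A : Matrix (Fin m × Fin 2) (Fin m × Fin 2) ℚ) (hA : Aᵀ = -A) :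
    pairingSum A ^ 2 = (2 ^ m * (Nat.factorial m : ℚ)) ^ 2 * A.det := by
  by_cases hdet : A.det = 0
  · rw [hdet, mul_zero]
    obtain ⟨w, hw, hAw⟩ := exists_mulVec_eq_zero_iff.2 hdet
    obtain ⟨i, hi⟩ : ∃ i, w i ≠ 0 := by
      by_contra! h
      exact hw (funext h)
    -- The identity with column `i` replaced by a kernel vector has determinant `w i ≠ 0`, and
    -- congruence by its transpose annihilates row and column `i`.
    set P : Matrix (Fin m × Fin 2) (Fin m × Fin 2) ℚ := (1 : Matrix _ _ ℚ).updateCol i w with hPdef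
    have hP : Pᵀ.det = w i := by
      rw [det_transpose, hPdef, ← cramer_apply, cramer_one]
      rfl
    have hcol : ∀ y, (Pᵀ * A * Pᵀᵀ) y i = 0 := fun y => by
      have : Pᵀᵀ *ᵥ Pi.single i 1 = w := by
        ext k
        simp [hPdef]
      have h2 : (Pᵀ * A * Pᵀᵀ) *ᵥ Pi.single i 1 = 0 := by
        rw [← mulVec_mulVec, this, ← mulVec_mulVec, hAw, mulVec_zero]
      simpa using congrFun h2 y
    have hskew : (Pᵀ * A * Pᵀᵀ)ᵀ = -(Pᵀ * A * Pᵀᵀ) := by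
      simp [hA, Matrix.mul_assoc]
    have hrow : ∀ y, (Pᵀ * A * Pᵀᵀ) i y = 0 := fun y => by
      have := congrFun (congrFun hskew y) i
      rw [transpose_apply, Matrix.neg_apply, hcol, neg_zero] at this
      exact this
    have h0 := pairingSum_congr Pᵀ A
    rw [pairingSum_eq_zero hrow hcol, hP] at h0
    have : pairingSum A = 0 := by simpa [hi] using h0.symm
    rw [this]
    simp
  · let e : Fin (m * 2) ≃ Fin m × Fin 2 := finProdFinEquiv.symm
    obtain ⟨m', f, P, hP⟩ := exists_symplectic_congr (m * 2) (A.submatrix e e)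
      (by rw [transpose_submatrix, hA]; rfl) (by rwa [det_submatrix_equiv_self])
    obtain rfl : m = m' := by simpa using Fintype.card_congr f
    have hA' : A = P.submatrix e.symm id * symplecticForm (Fin m) * (P.submatrix e.symm id)ᵀ := by
      have : A = (A.submatrix e e).submatrix e.symm e.symm := by simp
      rw [this, hP]
      rfl
    rw [hA', pairingSum_congr, pairingSum_symplecticForm, det_mul, det_mul, det_transpose,
      det_symplecticForm, Fintype.card_fin]
    ring

theorem finPfaffian_sq {N : ℕ} (A : Matrix (Fin N) (Fin N) ℚ) (hA : Aᵀ = -A) :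
    finPfaffian A ^ 2 = A.det := by
  by_cases hN : Even N
  · obtain ⟨m, rfl⟩ : ∃ m, N = m * 2 := ⟨N / 2, by have := Nat.even_iff.1 hN; omega⟩
    have hm : m * 2 / 2 = m := by omega
    let e : Fin m × Fin 2 ≃ Fin (m * 2) := finProdFinEquiv
    have h : (∑ σ : Perm (Fin (m * 2)), ((Perm.sign σ : ℤ) : ℚ) * ∏ i : Fin (m * 2 / 2),
        A (σ ⟨2 * i, by omega⟩) (σ ⟨2 * i + 1, by omega⟩)) = pairingSum (A.submatrix e e) := by
      rw [pairingSum]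
      refine Fintype.sum_equiv (Equiv.permCongr e.symm) _ _ fun σ => ?_
      congr 1
      · simp
      · refine Fintype.prod_equiv (finCongr hm) _ _ fun i => ?_
        have h0 : e (finCongr hm i, 0) = ⟨2 * i, by omega⟩ := Fin.ext (by simp [e])
        have h1 : e (finCongr hm i, 1) = ⟨2 * i + 1, by omega⟩ :=
          Fin.ext (by simp [e, finProdFinEquiv]; omega)
        rw [submatrix_apply, Equiv.permCongr_apply, Equiv.permCongr_apply, Equiv.symm_symm, h0, h1]
        simp
    rw [finPfaffian, if_pos hN, h, div_pow, pairingSum_sq _ (by rw [transpose_submatrix, hA]; rfl),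
      det_submatrix_equiv_self, hm, mul_div_assoc, mul_comm, div_mul_cancel₀]
    positivity
  · rw [finPfaffian, if_neg hN]
    have : A.det = (-1) ^ N * A.det := by
      conv_lhs => rw [← det_transpose, hA, det_neg, Fintype.card_fin]
    rw [(Nat.not_even_iff_odd.1 hN).neg_one_pow] at this
    linarith

/-- The square of the Pfaffian of an antisymmetric matrix is its determinant. -/
theorem pfaffian_sq {ι : Type*} [Fintype ι] [DecidableEq ι] (A : Matrix ι ι ℚ) (hA : Aᵀ = -A) :
    pfaffian A ^ 2 = A.det := by
  rw [pfaffian, finPfaffian_sq _ (by rw [transpose_submatrix, hA]; rfl), det_submatrix_equiv_self]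

end PfaffianSquare

/-! ### Expansion of a determinant in a diagonal perturbation. -/

section DiagonalExpansion

open Matrix

/-- Expansion of the determinant of a matrix in the entries of a diagonal perturbation. -/
theorem det_diagonal_add {ι R : Type*} [Fintype ι] [DecidableEq ι] [CommRing R] (d : ι → R)
    (B : Matrix ι ι R) :
    (diagonal d + B).det = ∑ Z : Finset ι, (∏ i ∈ Z, d i) *
      (B.submatrix (Subtype.val : {x // x ∉ Z} → ι) Subtype.val).det := by
  -- Multilinearity in the rows: `Z` collects the rows taken from the diagonal matrix. These vanish
  -- outside the columns of `Z`, so each summand is block triangular.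
  have h := (detRowAlternating (n := ι) (R := R)).map_add_univ (diagonal d) B
  refine h.trans (Finset.sum_congr rfl fun Z _ => ?_)
  change (of (Z.piecewise (diagonal d) B)).det = _
  rw [twoBlockTriangular_det' _ (· ∈ Z) fun i hi j hj => ?_]
  · congr 1
    · have : toSquareBlockProp (of (Z.piecewise (diagonal d) B)) (· ∈ Z) =
          diagonal fun i : {x // x ∈ Z} => d i := by
        ext ⟨i, hi⟩ ⟨j, hj⟩
        simp [toSquareBlockProp, Finset.piecewise, hi, diagonal_apply]
      rw [this]
      refine Eq.trans (@det_diagonal {x // x ∈ Z} _ (_) R _ _) ?_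
      exact (@Finset.prod_subtype ι R _ (· ∈ Z) (_) Z (fun _ => Iff.rfl) d).symm
    · congr 1
      ext ⟨i, hi⟩ ⟨j, hj⟩
      simp [toSquareBlockProp, Finset.piecewise, hi]
  · have : i ≠ j := fun e => hj (e ▸ hi)
    simp [Finset.piecewise, hi, this]

end DiagonalExpansion


/-! ### The expansion of `HU`. -/

namespace NCGraph

open Matrix

variable {V L : Type*} [Fintype V] [DecidableEq V] [Fintype L] [DecidableEq L]

instance Kept.decidablePred (root : V) (I J : Finset L) : DecidablePred (Kept root I J)
  | .inl l => inferInstanceAs (Decidable (l ∉ I))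
  | .inr (.inl l) => inferInstanceAs (Decidable (l ∉ J))
  | .inr (.inr _) => inferInstanceAs (Decidable True)

/-- The matrix `B` with the short variables of `I` and the long variables of `J` deleted. -/
abbrev keptB {R : Type*} [Ring R] (G : NCGraph V L) (root : V) (s : R) (I J : Finset L) :
    Matrix {x : Index V L root // Kept root I J x} {x : Index V L root // Kept root I J x} R :=
  (G.matB root s).submatrix Subtype.val Subtype.val

theorem omegaSign_swap (i j : Fin 4) : omegaSign j i = -omegaSign i j := by
  revert i j; decide

theorem oscillation_swap (a b : V → L → Fin 4 → ℤ) (l l' : L) :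
    oscillation a b l l' = -oscillation b a l' l := by
  simp only [oscillation, ← Finset.sum_neg_distrib]
  refine Finset.sum_congr rfl fun v _ => ?_
  rw [Finset.sum_comm]
  refine Finset.sum_congr rfl fun i _ => Finset.sum_congr rfl fun j _ => ?_
  rw [omegaSign_swap i j, add_comm (i : ℕ)]
  ring

theorem matB_transpose {R : Type*} [CommRing R] (G : NCGraph V L) (root : V) (s : R) :
    (G.matB root s)ᵀ = -G.matB root s := by
  ext (l | l | v) (l' | l' | v') <;>
    simp only [transpose_apply, Matrix.neg_apply, matB, neg_neg, neg_zero]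
  · rw [oscillation_swap]; simp
  · rw [oscillation_swap]; simp

theorem nPf_sq (G : NCGraph V L) (root : V) (I J : Finset L) :
    G.nPf root I J ^ 2 = (G.keptB root (1 : ℚ) I J).det := by
  have h : (G.keptB root (1 : ℚ) I J)ᵀ = -G.keptB root (1 : ℚ) I J := by
    rw [transpose_submatrix, matB_transpose]
    rfl
  rw [← pfaffian_sq _ h, nPf]
  congr!

theorem nPf_sq_cast (G : NCGraph V L) (root : V) (I J : Finset L) :
    ((G.nPf root I J ^ 2 : ℚ) : ℝ) = (G.keptB root (1 : ℝ) I J).det := by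
  rw [nPf_sq]
  refine (RingHom.map_det (Rat.castHom ℝ) _).trans (congrArg _ ?_)
  ext ⟨(l | l | v), h⟩ ⟨(l' | l' | v'), h'⟩ <;> simp [matB]

theorem prod_kept {M : Type*} [CommMonoid M] (root : V) (I J : Finset L)
    (f : Index V L root → M) :
    ∏ x : {x : Index V L root // Kept root I J x}, f x =
      (∏ l ∈ Iᶜ, f (.inl l)) * ((∏ l ∈ Jᶜ, f (.inr (.inl l))) * ∏ v, f (.inr (.inr v))) := by
  rw [← Finset.prod_subtype (Finset.univ.filter (Kept root I J)) (by simp)]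
  rw [Finset.prod_filter, Fintype.prod_sum_type, Fintype.prod_sum_type]
  have h : ∀ (S : Finset L) (g : L → M), ∏ l, (if l ∉ S then g l else 1) = ∏ l ∈ Sᶜ, g l :=
    fun S g => by
      rw [← Finset.prod_filter]
      exact Finset.prod_congr (by ext; simp) fun _ _ => rfl
  exact congrArg₂ _ (h I _) (congrArg₂ _ (h J _) (by simp [Kept]))

/-- Multiplying the short and long rows by `s` and the hypermomentum columns by `s⁻¹` turns `B` at 1
into `B` at `s`. The exponent is the number of kept short and long variables minus the number of
hypermomenta; the number of faces cancels between `twoGenus` and `kIndex`. -/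
theorem det_keptB (G : NCGraph V L) (root : V) {s : ℝ} (hs : 0 < s) (I J : Finset L) :
    (G.keptB root s I J).det =
      s ^ (G.twoGenus Finset.univ Finset.univ - G.kIndex I J) * (G.keptB root 1 I J).det := by
  let a : Index V L root → ℝ := Sum.elim (fun _ => s) (Sum.elim (fun _ => s) fun _ => 1)
  let b : Index V L root → ℝ := Sum.elim (fun _ => 1) (Sum.elim (fun _ => 1) fun _ => s⁻¹)
  have h : G.keptB root s I J = diagonal (fun x : {x // Kept root I J x} => a x) *
      G.keptB root 1 I J * diagonal (fun x : {x // Kept root I J x} => b x) := by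
    ext ⟨(l | l | v), h⟩ ⟨(l' | l' | v'), h'⟩ <;>
      simp [matB, a, b, mul_comm s, hs.ne']
  rw [h, det_mul, det_mul, det_diagonal, det_diagonal, prod_kept, prod_kept]
  have hexp : G.twoGenus Finset.univ Finset.univ - G.kIndex I J =
      (Iᶜ.card : ℤ) + (Jᶜ.card : ℤ) - (Fintype.card {v : V // v ≠ root} : ℤ) := by
    have hV : Fintype.card {v : V // v ≠ root} + 1 = Fintype.card V := by
      have := Fintype.card_pos_iff.2 ⟨root⟩
      rw [Fintype.card_subtype_compl, Fintype.card_subtype_eq]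
      omega
    have hI := Finset.card_add_card_compl I
    have hJ := Finset.card_add_card_compl J
    simp only [twoGenus, kIndex, Finset.card_univ]
    omega
  rw [hexp, zpow_sub₀ hs.ne', zpow_add₀ hs.ne']
  simp only [a, b, Sum.elim_inl, Sum.elim_inr, Finset.prod_const, zpow_natCast, Finset.card_univ,
    one_pow, inv_pow, div_eq_mul_inv]
  ring

theorem HU_eq_sum (G : NCGraph V L) (root : V) {s : ℝ} (hs : 0 < s) {t : L → ℝ}
    (ht : ∀ l, 0 < t l) :
    G.HU root s t = ∑ I : Finset L, ∑ J : Finset L,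
      s ^ (G.twoGenus Finset.univ Finset.univ - G.kIndex I J) * ((G.nPf root I J ^ 2 : ℚ) : ℝ) *
        (∏ l ∈ Iᶜ, t l) * ∏ l ∈ J, t l := by
  classical
  rw [HU, matA, det_diagonal_add, Finset.sum_mul, ← Finset.sumEquiv.symm.toEquiv.sum_comp,
    Fintype.sum_prod_type]
  refine Finset.sum_congr rfl fun I _ => ?_
  rw [← Finset.sumEquiv.symm.toEquiv.sum_comp, Fintype.sum_prod_type]
  refine Finset.sum_congr rfl fun J _ => ?_
  -- A deleted set containing a hypermomentum carries a zero factor of `A`.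
  rw [Fintype.sum_eq_single ∅]
  · have hdet : ((G.matB root s).submatrix (Subtype.val : {x // x ∉ I.disjSum (J.disjSum
        (∅ : Finset {v : V // v ≠ root}))} → Index V L root) Subtype.val).det =
        (G.keptB root s I J).det := by
      rw [← det_submatrix_equiv_self (Equiv.subtypeEquivRight (p := Kept root I J)
        (q := fun x => x ∉ I.disjSum (J.disjSum ∅)) _)]
      · rfl
      · rintro (l | l | v) <;> simp [Kept]
    have hI : (∏ l ∈ I, (t l)⁻¹) * ∏ l, t l = ∏ l ∈ Iᶜ, t l := by
      rw [← Finset.prod_mul_prod_compl I, ← mul_assoc, ← Finset.prod_mul_distrib,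
        Finset.prod_congr rfl fun l _ => inv_mul_cancel₀ (ht l).ne']
      simp
    change (∏ i ∈ I.disjSum (J.disjSum ∅), _) * ((G.matB root s).submatrix (Subtype.val :
      {x // x ∉ I.disjSum (J.disjSum (∅ : Finset {v : V // v ≠ root}))} → _) Subtype.val).det *
        _ = _
    rw [hdet, det_keptB G root hs, nPf_sq_cast, Finset.prod_disjSum, Finset.prod_disjSum]
    simp only [Sum.elim_inl, Sum.elim_inr, Finset.prod_empty, mul_one, ← hI]
    ring
  · intro K hK
    obtain ⟨v, hv⟩ := Finset.nonempty_iff_ne_empty.2 hK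
    refine mul_eq_zero_of_left (mul_eq_zero_of_left (Finset.prod_eq_zero
      (i := .inr (.inr v)) ?_ rfl) _) _
    change _ ∈ I.disjSum (J.disjSum K)
    simpa using hv

end NCGraph

/-! ### Corner functions, the oscillation form and walks around a spanning tree. -/

namespace NCGraph

open Matrix

variable {V L : Type*} [Fintype V] [DecidableEq V] [Fintype L] [DecidableEq L]

/-! ### The bilinear form on functions of the corners -/

/-- The short variable of a line as a function of the corners: `1` at both ends. -/
def short (G : NCGraph V L) (l : L) (h : V × Fin 4) : ℤ :=
  (if G.head l = h then 1 else 0) + (if G.tail l = h then 1 else 0)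

/-- The long variable of a line as a function of the corners: `1` at the head, `-1` at the tail. -/
def long (G : NCGraph V L) (l : L) (h : V × Fin 4) : ℤ :=
  (if G.head l = h then 1 else 0) - (if G.tail l = h then 1 else 0)

/-- The next corner of the same vertex. -/
def rot (h : V × Fin 4) : V × Fin 4 := (h.1, h.2 + 1)

/-- The antisymmetric form on functions of the corners. -/
def cornerForm (x y : V × Fin 4 → ℤ) : ℤ :=
  ∑ v : V, ∑ i : Fin 4, ∑ j : Fin 4, -omegaSign i j * x (v, i) * y (v, j)

/-- The incidence number of a line and a vertex. -/
def inc (G : NCGraph V L) (l : L) (v : V) : ℤ := ∑ i : Fin 4, G.long l (v, i)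

theorem sign_mul_eps (G : NCGraph V L) (v : V) (l : L) (i : Fin 4) :
    (-1) ^ (i : ℕ) * G.eps v l i = G.short l (v, i) := by
  have h : (-1 : ℤ) ^ (i : ℕ) * (-1) ^ (i : ℕ) = 1 := by rw [← mul_pow]; simp
  rw [eps, ← mul_assoc, h, one_mul, eta, short]
  by_cases h1 : G.head l = (v, i)
  · have h2 : G.tail l ≠ (v, i) := fun e => G.head_ne_tail l l (h1.trans e.symm)
    simp [h1, h2]
  · simp [h1]

theorem sign_mul_eta (G : NCGraph V L) (v : V) (l : L) (i : Fin 4) :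
    (-1) ^ (i : ℕ) * G.eta v l i = G.long l (v, i) := by
  rw [eta, long]
  by_cases h1 : G.head l = (v, i)
  · have h2 : G.tail l ≠ (v, i) := fun e => G.head_ne_tail l l (h1.trans e.symm)
    have := G.head_even l
    rw [h1] at this
    simp [h1, h2, this.neg_one_pow]
  · by_cases h2 : G.tail l = (v, i)
    · have := G.tail_odd l
      rw [h2] at this
      simp [h1, h2, this.neg_one_pow]
    · simp [h1, h2]

/-- The corner signs are absorbed into the functions `x` and `y`, so that all blocks of `E` become
values of one form, to which potential theory applies. -/
theorem oscillation_eq_cornerForm {a b : V → L → Fin 4 → ℤ} {x y : L → V × Fin 4 → ℤ}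
    (hx : ∀ v l (i : Fin 4), (-1) ^ (i : ℕ) * a v l i = x l (v, i))
    (hy : ∀ v l (i : Fin 4), (-1) ^ (i : ℕ) * b v l i = y l (v, i)) (l l' : L) :
    oscillation a b l l' = cornerForm (x l) (y l') := by
  simp only [oscillation, cornerForm, ← hx, ← hy]
  refine Finset.sum_congr rfl fun v _ => Finset.sum_congr rfl fun i _ =>
    Finset.sum_congr rfl fun j _ => ?_
  ring

/-- The form of a function of the corners with the variation of a potential. -/
theorem cornerForm_potential (x F : V × Fin 4 → ℤ) :
    cornerForm x (fun h => F (rot h) - F h) =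
      ∑ h, x h * (F (rot h) + F h) - ∑ v, 2 * F (v, 0) * ∑ i, x (v, i) := by
  rw [cornerForm, Fintype.sum_prod_type, ← Finset.sum_sub_distrib]
  refine Finset.sum_congr rfl fun v _ => ?_
  -- At a fixed corner the sums over later and earlier corners both telescope; the passage from
  -- corner 3 back to corner 0 produces the term `2 * F (v, 0)`, which is matched later by the
  -- hypermomenta.
  have e1 : (1 : Fin 4) + 1 = 2 := rfl
  have e2 : (2 : Fin 4) + 1 = 3 := rfl
  have e3 : (3 : Fin 4) + 1 = 0 := rfl
  simp [Fin.sum_univ_four, omegaSign, rot, e1, e2, e3]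
  ring

theorem cornerForm_add_right (x y z : V × Fin 4 → ℤ) :
    cornerForm x (fun h => y h + z h) = cornerForm x y + cornerForm x z := by
  simp only [cornerForm, mul_add, Finset.sum_add_distrib]

theorem cornerForm_sum_right {ι : Type*} (s : Finset ι) (b : ι → ℤ) (x : V × Fin 4 → ℤ)
    (y : ι → V × Fin 4 → ℤ) :
    cornerForm x (fun h => ∑ l ∈ s, b l * y l h) = ∑ l ∈ s, b l * cornerForm x (y l) := by
  classical
  induction s using Finset.induction with
  | empty => simp [cornerForm]
  | insert l s hl ih =>
    simp only [Finset.sum_insert hl]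
    rw [cornerForm_add_right, ih]
    congr 1
    simp only [cornerForm, Finset.mul_sum]
    exact Finset.sum_congr rfl fun v _ => Finset.sum_congr rfl fun i _ =>
      Finset.sum_congr rfl fun j _ => by ring

theorem sum_rot_sub (F : V × Fin 4 → ℤ) (v : V) : ∑ i, (F (rot (v, i)) - F (v, i)) = 0 := by
  rw [Finset.sum_sub_distrib, sub_eq_zero]
  exact Equiv.sum_comp (Equiv.addRight (1 : Fin 4)) fun i => F (v, i)

theorem sum_long_mul (G : NCGraph V L) (l : L) (f : V × Fin 4 → ℤ) :
    ∑ h, G.long l h * f h = f (G.head l) - f (G.tail l) := by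
  simp [long, sub_mul, Finset.sum_sub_distrib]

theorem sum_short_mul (G : NCGraph V L) (l : L) (f : V × Fin 4 → ℤ) :
    ∑ h, G.short l h * f h = f (G.head l) + f (G.tail l) := by
  simp [short, add_mul, Finset.sum_add_distrib]

theorem sum_corner_ite (h : V × Fin 4) (v : V) :
    ∑ i : Fin 4, (if h = (v, i) then (1 : ℤ) else 0) = if h.1 = v then 1 else 0 := by
  obtain ⟨w, j⟩ := h
  by_cases hw : w = v <;> simp [hw]

theorem inc_eq (G : NCGraph V L) (l : L) (v : V) :
    G.inc l v = (if (G.head l).1 = v then 1 else 0) - (if (G.tail l).1 = v then 1 else 0) := by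
  simp only [inc, long, Finset.sum_sub_distrib, sum_corner_ite]

/-! ### Ends of lines -/

theorem IsEnd.unique {G : NCGraph V L} {l l' : L} {h : V × Fin 4} (e : G.IsEnd l h)
    (e' : G.IsEnd l' h) : l = l' := by
  rcases e with e | e <;> rcases e' with e' | e'
  · exact G.head_injective (e.symm.trans e')
  · exact absurd (e.symm.trans e') (G.head_ne_tail l l')
  · exact absurd (e'.symm.trans e) (G.head_ne_tail l' l)
  · exact G.tail_injective (e.symm.trans e')

theorem otherEnd_of_forall_not (G : NCGraph V L) {S : Finset L} {h : V × Fin 4}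
    (hS : ∀ l ∈ S, ¬ G.IsEnd l h) : G.otherEnd S h = h := by
  rw [otherEnd, dif_neg, dif_neg]
  · rintro ⟨l, hl, e⟩
    exact hS l hl (Or.inr e.symm)
  · rintro ⟨l, hl, e⟩
    exact hS l hl (Or.inl e.symm)

theorem otherEnd_of_notMem (G : NCGraph V L) {S : Finset L} {l : L} (hl : l ∉ S) {h : V × Fin 4}
    (e : G.IsEnd l h) : G.otherEnd S h = h :=
  G.otherEnd_of_forall_not fun _ hl' e' => hl (e.unique e' ▸ hl')

theorem faceStep_apply (G : NCGraph V L) (S : Finset L) (h : V × Fin 4) :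
    G.faceStep S h = rot (G.otherEnd S h) := rfl

theorem long_otherEnd (G : NCGraph V L) {T : Finset L} {l : L} (hl : l ∉ T) (h : V × Fin 4) :
    G.long l (G.otherEnd T h) = G.long l h := by
  by_cases hT : ∃ l' ∈ T, G.IsEnd l' h
  · obtain ⟨l', hl', e⟩ := hT
    have zero : ∀ k, G.IsEnd l' k → G.long l k = 0 := fun k hk => by
      have h1 : G.head l ≠ k := fun e1 => hl (IsEnd.unique (Or.inl e1.symm) hk ▸ hl')
      have h2 : G.tail l ≠ k := fun e2 => hl (IsEnd.unique (Or.inr e2.symm) hk ▸ hl')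
      simp [long, h1, h2]
    rw [zero h e, zero]
    rcases e with rfl | rfl
    · rw [otherEnd_head G hl']; exact Or.inr rfl
    · rw [otherEnd_tail G hl']; exact Or.inl rfl
  · push Not at hT
    rw [G.otherEnd_of_forall_not hT]

/-- The variation of a function along the lines of `T` is a combination of long variables. -/
theorem sub_otherEnd_eq_sum (G : NCGraph V L) (T : Finset L) (F : V × Fin 4 → ℤ) (h : V × Fin 4) :
    F (G.otherEnd T h) - F h = ∑ l ∈ T, (F (G.tail l) - F (G.head l)) * G.long l h := by
  by_cases hT : ∃ l ∈ T, G.IsEnd l h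
  · obtain ⟨l, hl, e⟩ := hT
    rw [Finset.sum_eq_single_of_mem l hl]
    · rcases e with rfl | rfl
      · have := G.head_ne_tail l l
        rw [otherEnd_head G hl]
        simp [long, this.symm]
      · have := G.head_ne_tail l l
        rw [otherEnd_tail G hl]
        simp [long, this]
    · intro l' _ hne
      have h1 : G.head l' ≠ h := fun e1 => hne (IsEnd.unique (Or.inl e1.symm) e)
      have h2 : G.tail l' ≠ h := fun e2 => hne (IsEnd.unique (Or.inr e2.symm) e)
      simp [long, h1, h2]
  · push Not at hT
    rw [G.otherEnd_of_forall_not hT, sub_self, Finset.sum_eq_zero]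
    intro l hl
    have h1 : G.head l ≠ h := fun e1 => hT l hl (Or.inl e1.symm)
    have h2 : G.tail l ≠ h := fun e2 => hT l hl (Or.inr e2.symm)
    simp [long, h1, h2]

/-- The variation around a vertex of a function whose variation along the faces of `T` is `r`. -/
theorem rot_sub_eq (G : NCGraph V L) (T : Finset L) {F r : V × Fin 4 → ℤ}
    (hF : ∀ h, F (G.faceStep T h) = F h + r h) (h : V × Fin 4) :
    F (rot h) - F h = r (G.otherEnd T h) +
      ∑ l ∈ T, (F (G.tail l) - F (G.head l)) * G.long l h := by
  have h1 := hF (G.otherEnd T h)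
  rw [faceStep_apply, G.otherEnd_involutive T h] at h1
  rw [h1, ← sub_otherEnd_eq_sum]
  ring

/-! ### Flows on trees -/

theorem Joined.exists_flow {G : NCGraph V L} {T : Finset L} {v w : V} (hvw : G.Joined T v w) :
    ∃ d : L → ℤ, (∀ l ∉ T, d l = 0) ∧
      ∀ x, ∑ l ∈ T, d l * G.inc l x = (if w = x then 1 else 0) - (if v = x then 1 else 0) := by
  obtain ⟨l, hl, ⟨rfl, rfl⟩ | ⟨rfl, rfl⟩⟩ := hvw
  · refine ⟨Pi.single l (-1), fun l' hl' => ?_, fun x => ?_⟩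
    · exact Pi.single_eq_of_ne (fun e : l' = l => hl' (e ▸ hl)) _
    · rw [Finset.sum_eq_single_of_mem l hl fun l' _ hne => by simp [hne], inc_eq]
      simp
  · refine ⟨Pi.single l 1, fun l' hl' => ?_, fun x => ?_⟩
    · exact Pi.single_eq_of_ne (fun e : l' = l => hl' (e ▸ hl)) _
    · rw [Finset.sum_eq_single_of_mem l hl fun l' _ hne => by simp [hne], inc_eq]
      simp

/-- A path gives a unit flow between its ends. -/
theorem exists_flow_of_reflTransGen {G : NCGraph V L} {T : Finset L} {v w : V}
    (hvw : Relation.ReflTransGen (G.Joined T) v w) :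
    ∃ d : L → ℤ, (∀ l ∉ T, d l = 0) ∧
      ∀ x, ∑ l ∈ T, d l * G.inc l x = (if w = x then 1 else 0) - (if v = x then 1 else 0) := by
  induction hvw with
  | refl => exact ⟨0, fun _ _ => rfl, fun x => by simp⟩
  | tail _ h ih =>
    obtain ⟨d, hd, hdx⟩ := ih
    obtain ⟨d', hd', hdx'⟩ := h.exists_flow
    refine ⟨d + d', fun l hl => by simp [hd l hl, hd' l hl], fun x => ?_⟩
    simp only [Pi.add_apply, add_mul, Finset.sum_add_distrib, hdx, hdx']
    ring

/-- The incidence matrix of the lines of `T` and the vertices other than the root. -/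
def incMatrix (G : NCGraph V L) (root : V) (T : Finset L) :
    Matrix {l // l ∈ T} {v : V // v ≠ root} ℤ := fun l v => G.inc l v

/-- The reduced incidence matrix of a spanning tree is invertible over the integers. -/
theorem IsTreeOn.exists_inverse {G : NCGraph V L} {T : Finset L} (hT : G.IsTreeOn T Finset.univ)
    (root : V) : ∃ D : Matrix {v : V // v ≠ root} {l // l ∈ T} ℤ,
      G.incMatrix root T * D = 1 ∧ D * G.incMatrix root T = 1 := by
  -- The unit flows along tree paths from the root are the rows of the inverse. Both index types
  -- have one element fewer than `V`, so a one-sided inverse suffices.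
  choose d _ hd using fun v : V => exists_flow_of_reflTransGen
    (hT.2.2 root (Finset.mem_univ _) v (Finset.mem_univ _))
  let D : Matrix {v : V // v ≠ root} {l // l ∈ T} ℤ := fun v l => d v l
  have hDC : D * G.incMatrix root T = 1 := by
    ext v w
    rw [Matrix.mul_apply, one_apply]
    have := hd v w
    rw [← Finset.sum_coe_sort] at this
    simpa [D, incMatrix, w.2.symm, Subtype.ext_iff] using this
  have hcard : Fintype.card {v : V // v ≠ root} = Fintype.card {l // l ∈ T} := by
    have h1 := hT.1
    rw [Fintype.card_subtype_compl, Fintype.card_subtype_eq, Fintype.card_coe]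
    rw [Finset.card_univ] at h1
    omega
  exact ⟨D, (Matrix.mul_eq_one_comm_of_card_eq _ _ _ hcard).1 hDC, hDC⟩

/-- A flow on a spanning tree without sources is zero. -/
theorem IsTreeOn.flow_eq_zero {G : NCGraph V L} {T : Finset L} (hT : G.IsTreeOn T Finset.univ)
    {b : L → ℤ} (hb : ∀ v, ∑ l ∈ T, b l * G.inc l v = 0) : ∀ l ∈ T, b l = 0 := by
  intro l hl
  obtain ⟨D, hCD, _⟩ := hT.exists_inverse (G.head l).1
  have h : (fun l : {l // l ∈ T} => b l) ᵥ* G.incMatrix (G.head l).1 T = 0 := by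
    ext v
    have := hb v
    rw [← Finset.sum_coe_sort] at this
    simpa [vecMul, dotProduct, incMatrix] using this
  have h2 := congrArg (· ᵥ* D) h
  simp only [vecMul_vecMul, hCD, vecMul_one, zero_vecMul] at h2
  exact congrFun h2 ⟨l, hl⟩

/-- Walking around a spanning tree one meets all the corners. -/
theorem IsTreeOn.exists_pow_faceStep {G : NCGraph V L} {T : Finset L}
    (hT : G.IsTreeOn T Finset.univ) (h₀ h : V × Fin 4) : ∃ k : ℕ, (G.faceStep T ^ k) h₀ = h := by
  classical
  -- The indicator of an orbit is invariant under the walk, so its differences across tree lines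
  -- form a flow without sources. This vanishes on a tree; the indicator is therefore constant and
  -- the orbit is everything.
  let F : V × Fin 4 → ℤ := fun h => if (G.faceStep T).SameCycle h₀ h then 1 else 0
  have hF : ∀ h, F (G.faceStep T h) = F h + 0 := fun h => by
    simp only [F, Equiv.Perm.sameCycle_apply_right, add_zero]
  have hrot := G.rot_sub_eq T (r := fun _ => 0) hF
  have hb : ∀ l ∈ T, F (G.tail l) - F (G.head l) = 0 := by
    refine hT.flow_eq_zero fun v => ?_
    have := sum_rot_sub F v
    simp only [hrot, zero_add] at this
    rw [Finset.sum_comm] at this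
    simpa only [inc, Finset.mul_sum] using this
  have hconst : ∀ h, F (rot h) = F h := fun h => by
    rw [← sub_eq_zero, hrot, zero_add]
    exact Finset.sum_eq_zero fun l hl => by rw [hb l hl, zero_mul]
  have hvert : ∀ v i, F (v, i) = F (v, 0) := by
    intro v i
    have h0 := hconst (v, 0)
    have h1 := hconst (v, 1)
    have h2 := hconst (v, 2)
    have e1 : rot (v, (0 : Fin 4)) = (v, 1) := rfl
    have e2 : rot (v, (1 : Fin 4)) = (v, 2) := rfl
    have e3 : rot (v, (2 : Fin 4)) = (v, 3) := rfl
    rw [e1] at h0; rw [e2] at h1; rw [e3] at h2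
    fin_cases i
    · rfl
    · exact h0
    · exact h1.trans h0
    · exact h2.trans (h1.trans h0)
  have hjoin : ∀ v w, Relation.ReflTransGen (G.Joined T) v w → F (v, 0) = F (w, 0) := by
    intro v w hvw
    induction hvw with
    | refl => rfl
    | tail _ hj ih =>
      rw [ih]
      obtain ⟨l, hl, hj⟩ := hj
      have h1 : F (G.head l) = F ((G.head l).1, 0) := hvert _ _
      have h2 : F (G.tail l) = F ((G.tail l).1, 0) := hvert _ _
      have h3 := hb l hl
      obtain ⟨rfl, rfl⟩ | ⟨rfl, rfl⟩ := hj <;> linarith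
  have h1 : F h = 1 := by
    have : F h₀ = 1 := if_pos (Equiv.Perm.SameCycle.refl _ _)
    rw [← this]
    obtain ⟨v, i⟩ := h
    obtain ⟨w, j⟩ := h₀
    rw [hvert v, hvert w, hjoin v w (hT.2.2 _ (Finset.mem_univ _) _ (Finset.mem_univ _))]
  have hs : (G.faceStep T).SameCycle h₀ h := by
    by_contra hn
    simp [F, hn] at h1
  obtain ⟨k, _, hk⟩ := hs.exists_pow_eq'
  exact ⟨k, hk⟩

end NCGraph

/-! ### Positions along a cyclic permutation. -/

section CyclicPosition

variable {H : Type*}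

/-- The number of steps of `f` which lead from `h₀` to `h` (for the first time). -/
noncomputable def cyclePos (f : Equiv.Perm H) (h₀ h : H) : ℕ := sInf {k : ℕ | (f ^ k) h₀ = h}

variable {f : Equiv.Perm H} {h₀ : H}

theorem cyclePos_self : cyclePos f h₀ h₀ = 0 := Nat.sInf_eq_zero.2 (Or.inl rfl)

theorem pow_cyclePos (hf : ∀ h, ∃ k : ℕ, (f ^ k) h₀ = h) (h : H) :
    (f ^ cyclePos f h₀ h) h₀ = h := Nat.sInf_mem (hf h)

theorem cyclePos_le {k : ℕ} {h : H} (hk : (f ^ k) h₀ = h) : cyclePos f h₀ h ≤ k := Nat.sInf_le hk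

theorem cyclePos_injective (hf : ∀ h, ∃ k : ℕ, (f ^ k) h₀ = h) :
    Function.Injective (cyclePos f h₀) := fun a b hab => by
  rw [← pow_cyclePos hf a, hab, pow_cyclePos hf b]

theorem cyclePos_apply (hf : ∀ h, ∃ k : ℕ, (f ^ k) h₀ = h) {h : H} (hne : f h ≠ h₀) :
    cyclePos f h₀ (f h) = cyclePos f h₀ h + 1 := by
  refine le_antisymm (cyclePos_le (by rw [pow_succ', Equiv.Perm.mul_apply, pow_cyclePos hf])) ?_
  have h1 := pow_cyclePos hf (f h)
  obtain ⟨k, hk⟩ : ∃ k, cyclePos f h₀ (f h) = k + 1 := Nat.exists_eq_succ_of_ne_zero fun h0 => by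
    rw [h0] at h1
    exact hne h1.symm
  rw [hk, pow_succ', Equiv.Perm.mul_apply] at h1
  rw [hk]
  exact Nat.succ_le_succ (cyclePos_le (f.injective h1))

/-- A corner met after the walk has closed up could be reached sooner by removing one full turn. -/
theorem cyclePos_le_of_apply_eq (hf : ∀ h, ∃ k : ℕ, (f ^ k) h₀ = h) {h : H} (he : f h = h₀)
    (a : H) : cyclePos f h₀ a ≤ cyclePos f h₀ h := by
  by_contra! hlt
  have h1 : (f ^ (cyclePos f h₀ h + 1)) h₀ = h₀ := by
    rw [pow_succ', Equiv.Perm.mul_apply, pow_cyclePos hf, he]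
  have h2 := pow_cyclePos hf a
  have h3 : cyclePos f h₀ a = (cyclePos f h₀ a - (cyclePos f h₀ h + 1)) + (cyclePos f h₀ h + 1) := by
    omega
  rw [h3, pow_add, Equiv.Perm.mul_apply, h1] at h2
  have := cyclePos_le h2
  omega

/-- The variation along the cycle of the indicator of the part which begins at `a`. -/
theorem indicator_le_cyclePos_apply (hf : ∀ h, ∃ k : ℕ, (f ^ k) h₀ = h) (a h : H)
    [DecidableEq H] :
    (if cyclePos f h₀ a ≤ cyclePos f h₀ (f h) then (1 : ℤ) else 0) =
      (if cyclePos f h₀ a ≤ cyclePos f h₀ h then 1 else 0) +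
        ((if f h = a then 1 else 0) - (if f h = h₀ then 1 else 0)) := by
  by_cases he : f h = h₀
  -- The closing step leads from the last position to position 0, where the indicator falls from 1
  -- to 0 unless `a` is the origin itself.
  · have hle := cyclePos_le_of_apply_eq hf he a
    rw [he, cyclePos_self, if_pos hle, if_pos rfl]
    by_cases ha : h₀ = a
    · simp [ha, cyclePos_self]
    · have : cyclePos f h₀ a ≠ 0 := fun h0 =>
        ha (cyclePos_injective hf (cyclePos_self.trans h0.symm))
      simp [ha, this]
  · rw [if_neg he, sub_zero, cyclePos_apply hf he]
    by_cases ha : f h = a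
    · have := cyclePos_apply hf he
      rw [ha] at this
      simp [ha, this]
    · have : cyclePos f h₀ a ≠ cyclePos f h₀ h + 1 := fun e =>
        ha (cyclePos_injective hf ((cyclePos_apply hf he).trans e.symm))
      by_cases hlt : cyclePos f h₀ a ≤ cyclePos f h₀ h
      · simp [ha, hlt, hlt.trans (Nat.le_succ _)]
      · have : ¬ cyclePos f h₀ a ≤ cyclePos f h₀ h + 1 := by omega
        simp [ha, hlt, this]

/-- The variation along the cycle of the indicator of the part which begins after `a`. -/
theorem indicator_lt_cyclePos_apply (hf : ∀ h, ∃ k : ℕ, (f ^ k) h₀ = h) (a h : H)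
    [DecidableEq H] :
    (if cyclePos f h₀ a < cyclePos f h₀ (f h) then (1 : ℤ) else 0) =
      (if cyclePos f h₀ a < cyclePos f h₀ h then 1 else 0) +
        ((if a = h then 1 else 0) - (if f h = h₀ then 1 else 0)) := by
  have key : ∀ k, (if cyclePos f h₀ a < cyclePos f h₀ k then (1 : ℤ) else 0) =
      (if cyclePos f h₀ a ≤ cyclePos f h₀ k then 1 else 0) - (if a = k then 1 else 0) := fun k => by
    by_cases hk : a = k
    · simp [hk]
    · have : cyclePos f h₀ a ≠ cyclePos f h₀ k := fun e => hk (cyclePos_injective hf e)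
      simp only [hk, if_false, sub_zero, lt_iff_le_and_ne, this, ne_eq, not_false_iff, and_true]
  rw [key, key, indicator_le_cyclePos_apply hf a h]
  have : (if a = f h then (1 : ℤ) else 0) = if f h = a then 1 else 0 := by simp only [eq_comm]
  rw [this]
  ring

end CyclicPosition

/-! ### Schur complements of skew integer matrices. -/

section SchurComplement

open Matrix

/-- An antisymmetric matrix of size `2 + β` whose block on `β` is invertible over the integers. -/
theorem natAbs_det_fromBlocks_skew {β : Type*} [Fintype β] [DecidableEq β]
    {X : Matrix (Fin 2) (Fin 2) ℤ} {Y : Matrix (Fin 2) β ℤ} {K K' : Matrix β β ℤ}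
    (hX : Xᵀ = -X) (hK : Kᵀ = -K) (hKK : K * K' = 1) {w : β → ℤ} (hw : ∀ i, (K *ᵥ w) i = Y 1 i) :
    (fromBlocks X Y (-Yᵀ) K).det.natAbs = (X 0 1 + (Y *ᵥ w) 0).natAbs ^ 2 := by
  have hK'K : K' * K = 1 := mul_eq_one_comm.1 hKK
  let _ : Invertible K := ⟨K', hK'K, hKK⟩
  have hinv : ⅟K = K' := rfl
  have hdetK : K.det.natAbs = 1 := by
    have := congrArg det hKK
    rw [det_mul, det_one] at this
    exact Int.isUnit_iff_natAbs_eq.1 (IsUnit.of_mul_eq_one _ this)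
  have hK' : K'ᵀ = -K' := by
    have h1 : K'ᵀ * K = -1 := by
      have := congrArg transpose hKK
      rw [transpose_mul, hK, transpose_one, Matrix.mul_neg] at this
      rw [← this, neg_neg]
    calc K'ᵀ = K'ᵀ * (K * K') := by rw [hKK, Matrix.mul_one]
      _ = -K' := by rw [← Matrix.mul_assoc, h1, Matrix.neg_mul, Matrix.one_mul]
  set S : Matrix (Fin 2) (Fin 2) ℤ := X + Y * K' * Yᵀ with hS
  have hST : Sᵀ = -S := by
    rw [hS, transpose_add, transpose_mul, transpose_mul, transpose_transpose, hX, hK']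
    simp only [Matrix.mul_assoc, Matrix.neg_mul, Matrix.mul_neg]
    abel
  have hdet : (fromBlocks X Y (-Yᵀ) K).det = K.det * S.det := by
    rw [det_fromBlocks₂₂, hS, hinv, Matrix.mul_neg, sub_neg_eq_add]
  have hS01 : S 0 1 = X 0 1 + (Y *ᵥ w) 0 := by
    -- Only the solution of one linear system enters the relevant entry; being skew, the 2 × 2
    -- complement has that entry squared as determinant.
    have h1 : w = K' *ᵥ (fun i => Y 1 i) := by
      rw [← funext hw, mulVec_mulVec, hK'K, one_mulVec]
    rw [h1, hS, mulVec_mulVec]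
    rfl
  have hent : ∀ i j, S i j = -S j i := fun i j => by
    have := congrFun (congrFun hST j) i
    simpa using this
  have h00 := hent 0 0
  have h11 := hent 1 1
  have h10 := hent 1 0
  have hSdet : S.det = S 0 1 ^ 2 := by
    rw [det_fin_two, h10, show S 0 0 = 0 by omega]
    ring
  rw [hdet, hSdet, Int.natAbs_mul, hdetK, one_mul, Int.natAbs_pow, hS01]

/-- A bordered matrix with invertible borders is invertible. -/
theorem fromBlocks_bordered_mul {α β : Type*} [Fintype α] [DecidableEq α] [Fintype β]
    [DecidableEq β] {E : Matrix α α ℤ} {C : Matrix α β ℤ} {D : Matrix β α ℤ} (hCD : C * D = 1)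
    (hDC : D * C = 1) :
    fromBlocks E C (-Cᵀ) 0 * fromBlocks 0 (-Dᵀ) D (D * E * Dᵀ) = 1 := by
  have h1 : Cᵀ * Dᵀ = 1 := by rw [← transpose_mul, hDC, transpose_one]
  rw [fromBlocks_multiply, ← fromBlocks_one]
  congr 1
  · simp [hCD]
  · rw [← Matrix.mul_assoc C, ← Matrix.mul_assoc C, hCD]
    simp
  · simp
  · simp [h1]

end SchurComplement

/-! ### The potential of a loop line and the reduced determinant. -/

namespace NCGraph

open Matrix

variable {V L : Type*} [Fintype V] [DecidableEq V] [Fintype L] [DecidableEq L]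

theorem pos_injective {G : NCGraph V L} {T : Finset L} (hT : G.IsTreeOn T Finset.univ) (root : V) :
    Function.Injective (G.pos root T) := cyclePos_injective (hT.exists_pow_faceStep _)

/-- The potential of the line `l` in the rosette of `T`: up to sign, the indicator of the corners
between the ends of `l`. -/
noncomputable def potential (G : NCGraph V L) (root : V) (T : Finset L) (l : L) (h : V × Fin 4) :
    ℤ :=
  (if G.pos root T (G.head l) < G.pos root T h then 1 else 0) -
    (if G.pos root T (G.tail l) < G.pos root T h then 1 else 0)

theorem potential_root (G : NCGraph V L) (root : V) (T : Finset L) (l : L) :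
    G.potential root T l (root, 0) = 0 := by
  have : G.pos root T (root, 0) = 0 := cyclePos_self
  simp [potential, this]

/-- Strict inequalities make the potential jump just after an end of `l`; the drops of the two
indicators when the walk returns to the root cancel. -/
theorem potential_faceStep {G : NCGraph V L} {T : Finset L} (hT : G.IsTreeOn T Finset.univ)
    (root : V) (l : L) (h : V × Fin 4) :
    G.potential root T l (G.faceStep T h) = G.potential root T l h + G.long l h := by
  have key := indicator_lt_cyclePos_apply (hT.exists_pow_faceStep (root, 0))
  have h1 := key (G.head l) h
  have h2 := key (G.tail l) h
  change (if G.pos root T (G.head l) < G.pos root T (G.faceStep T h) then (1 : ℤ) else 0) -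
    (if G.pos root T (G.tail l) < G.pos root T (G.faceStep T h) then 1 else 0) =
    (if G.pos root T (G.head l) < G.pos root T h then 1 else 0) -
    (if G.pos root T (G.tail l) < G.pos root T h then 1 else 0) + _
  unfold pos at *
  unfold cyclePos at *
  rw [h1, h2, long]
  ring

section Reduction

variable {G : NCGraph V L} {T : Finset L} {F : V × Fin 4 → ℤ} {l₂ : L}

theorem rot_sub_eq_long (hF : ∀ h, F (G.faceStep T h) = F h + G.long l₂ h) (hl₂ : l₂ ∉ T)
    (h : V × Fin 4) : F (rot h) - F h =
      G.long l₂ h + ∑ l ∈ T, (F (G.tail l) - F (G.head l)) * G.long l h := by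
  rw [G.rot_sub_eq T hF, long_otherEnd G hl₂]

theorem inc_add_sum_eq_zero (hF : ∀ h, F (G.faceStep T h) = F h + G.long l₂ h) (hl₂ : l₂ ∉ T)
    (v : V) : G.inc l₂ v + ∑ l ∈ T, (F (G.tail l) - F (G.head l)) * G.inc l v = 0 := by
  have := sum_rot_sub F v
  simp only [rot_sub_eq_long hF hl₂, Finset.sum_add_distrib] at this
  rw [Finset.sum_comm] at this
  simpa only [inc, Finset.mul_sum] using this

/-- This is `cornerForm_potential` with the variation of `F` written in long variables. The root may
be left out of the vertex sum because `F` is normalised to vanish at its first corner. -/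
theorem cornerForm_reduction (hF : ∀ h, F (G.faceStep T h) = F h + G.long l₂ h) (hl₂ : l₂ ∉ T)
    {root : V} (hroot : F (root, 0) = 0) (x : V × Fin 4 → ℤ) :
    cornerForm x (G.long l₂) +
      ((∑ l : {l // l ∈ T}, cornerForm x (G.long l) * (F (G.tail l) - F (G.head l))) +
        ∑ v : {v : V // v ≠ root}, (∑ i, x (v, i)) * (2 * F (v, 0))) =
      ∑ h, x h * (F (rot h) + F h) := by
  have h1 := cornerForm_potential x F
  simp only [rot_sub_eq_long hF hl₂] at h1
  rw [cornerForm_add_right, cornerForm_sum_right] at h1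
  have h2 : ∑ v, 2 * F (v, 0) * ∑ i, x (v, i) =
      ∑ v : {v : V // v ≠ root}, (∑ i, x (v, i)) * (2 * F (v, 0)) := by
    rw [← Finset.add_sum_erase _ _ (Finset.mem_univ root), hroot, mul_zero, zero_mul, zero_add]
    rw [Finset.sum_subtype (p := (· ≠ root)) _ (by simp)]
    exact Finset.sum_congr rfl fun _ _ => mul_comm _ _
  have h3 : ∑ l ∈ T, (F (G.tail l) - F (G.head l)) * cornerForm x (G.long l) =
      ∑ l : {l // l ∈ T}, cornerForm x (G.long l) * (F (G.tail l) - F (G.head l)) := by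
    rw [← Finset.sum_coe_sort]
    exact Finset.sum_congr rfl fun _ _ => mul_comm _ _
  rw [h2, h3] at h1
  linarith

/-- The walk crosses a tree line from each end to the corner after the opposite end, and `F` does
not change there; so `F ∘ rot + F` takes the same value at both ends. -/
theorem potential_tree_line (hF : ∀ h, F (G.faceStep T h) = F h + G.long l₂ h) (hl₂ : l₂ ∉ T)
    {l : L} (hl : l ∈ T) : ∑ h, G.long l h * (F (rot h) + F h) = 0 := by
  have zero : ∀ k, G.IsEnd l k → G.long l₂ k = 0 := fun k hk => by
    have h1 : G.head l₂ ≠ k := fun e1 => hl₂ (IsEnd.unique (Or.inl e1.symm) hk ▸ hl)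
    have h2 : G.tail l₂ ≠ k := fun e2 => hl₂ (IsEnd.unique (Or.inr e2.symm) hk ▸ hl)
    simp [long, h1, h2]
  have h1 := hF (G.head l)
  have h2 := hF (G.tail l)
  rw [faceStep_apply, otherEnd_head G hl, zero _ (Or.inl rfl)] at h1
  rw [faceStep_apply, otherEnd_tail G hl, zero _ (Or.inr rfl)] at h2
  rw [sum_long_mul, h1, h2]
  ring

theorem potential_rot_of_loop (hF : ∀ h, F (G.faceStep T h) = F h + G.long l₂ h)
    {l : L} (hl : l ∉ T) (hne : l ≠ l₂) {h : V × Fin 4} (e : G.IsEnd l h) : F (rot h) = F h := by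
  have h1 := hF h
  rw [faceStep_apply, otherEnd_of_notMem G hl e] at h1
  have h2 : G.head l₂ ≠ h := fun e1 => hne (e.unique (Or.inl e1.symm))
  have h3 : G.tail l₂ ≠ h := fun e1 => hne (e.unique (Or.inr e1.symm))
  simpa [long, h2, h3] using h1

end Reduction

theorem matB_one_uv (G : NCGraph V L) (root : V) (l l' : L) :
    G.matB root (1 : ℤ) (.inl l) (.inr (.inl l')) = cornerForm (G.short l) (G.long l') := by
  simp [matB, oscillation_eq_cornerForm G.sign_mul_eps G.sign_mul_eta]

theorem matB_one_vv (G : NCGraph V L) (root : V) (l l' : L) :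
    G.matB root (1 : ℤ) (.inr (.inl l)) (.inr (.inl l')) =
      cornerForm (G.long l) (G.long l') := by
  simp [matB, oscillation_eq_cornerForm G.sign_mul_eta G.sign_mul_eta]

theorem matB_one_up (G : NCGraph V L) (root : V) (l : L) (v : {v : V // v ≠ root}) :
    G.matB root (1 : ℤ) (.inl l) (.inr (.inr v)) = ∑ i, G.short l (v, i) := by
  simp [matB, sign_mul_eps]

theorem matB_one_vp (G : NCGraph V L) (root : V) (l : L) (v : {v : V // v ≠ root}) :
    G.matB root (1 : ℤ) (.inr (.inl l)) (.inr (.inr v)) = G.inc l v := by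
  simp [matB, sign_mul_eta, inc]

/-- The determinant of the reduced matrix. -/
theorem natAbs_det_keptB {G : NCGraph V L} (root : V) {T : Finset L} {lt l₂ : L} {J₀ : Finset L}
    (hJ : G.IsPseudoAdmissible T lt l₂ J₀) (hne : lt ≠ l₂) :
    (G.keptB root (1 : ℤ) {lt}ᶜ J₀).det.natAbs =
      (2 * (G.potential root T l₂ (G.head lt) + G.potential root T l₂ (G.tail lt))).natAbs ^ 2 := by
  obtain ⟨hT, hJ₀, hlt, hl₂⟩ := hJ
  set F := G.potential root T l₂ with hFdef
  have hF : ∀ h, F (G.faceStep T h) = F h + G.long l₂ h := potential_faceStep hT root l₂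
  have hroot : F (root, 0) = 0 := potential_root G root T l₂
  have memJ : ∀ l, l ∉ J₀ ↔ l = l₂ ∨ l ∈ T := fun l => by
    rw [← Finset.mem_compl, hJ₀, Finset.mem_insert]
  let f : Fin 2 ⊕ ({l // l ∈ T} ⊕ {v : V // v ≠ root}) → Index V L root :=
    Sum.elim ![.inl lt, .inr (.inl l₂)] (Sum.elim (fun l => .inr (.inl l)) fun v => .inr (.inr v))
  have hfK : ∀ x, Kept root {lt}ᶜ J₀ (f x) := by
    rintro (i | l | v)
    · fin_cases i
      · simp [f, Kept]
      · simpa [f, Kept] using (memJ l₂).2 (Or.inl rfl)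
    · exact (memJ l).2 (Or.inr l.2)
    · trivial
  have hbij : Function.Bijective fun x => (⟨f x, hfK x⟩ : {x // Kept root {lt}ᶜ J₀ x}) := by
    constructor
    · intro x y hxy
      have hxy' : f x = f y := congrArg Subtype.val hxy
      rcases x with i | l | v <;> rcases y with j | l' | v'
      · fin_cases i <;> fin_cases j <;> first | rfl | exact absurd hxy' (by simp [f])
      · fin_cases i
        · simp [f] at hxy'
        · simp only [f, Sum.elim_inl, Sum.elim_inr] at hxy'
          have : l₂ = l' := by simpa using hxy'
          exact absurd l'.2 (this ▸ hl₂)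
      · fin_cases i <;> simp [f] at hxy'
      · fin_cases j
        · simp [f] at hxy'
        · simp only [f, Sum.elim_inl, Sum.elim_inr] at hxy'
          have : l = l₂ := by simpa using hxy'
          exact absurd l.2 (this ▸ hl₂)
      · rw [Subtype.ext (Sum.inl.inj (Sum.inr.inj hxy'))]
      · simp [f] at hxy'
      · fin_cases j <;> simp [f] at hxy'
      · simp [f] at hxy'
      · rw [Sum.inr.inj (Sum.inr.inj hxy')]
    · rintro ⟨l | l | v, hx⟩
      · have : l = lt := by simpa [Kept] using hx
        exact ⟨.inl 0, by simp [f, this]⟩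
      · rcases (memJ l).1 hx with rfl | h
        · exact ⟨.inl 1, by simp [f]⟩
        · exact ⟨.inr (.inl ⟨l, h⟩), by simp [f]⟩
      · exact ⟨.inr (.inr v), by simp [f]⟩
  have hskew : ∀ i j, G.matB root (1 : ℤ) i j = -G.matB root (1 : ℤ) j i := fun i j => by
    have := congrFun (congrFun (G.matB_transpose root (1 : ℤ)) j) i
    simpa using this
  let X : Matrix (Fin 2) (Fin 2) ℤ := fun i j => G.matB root 1 (f (.inl i)) (f (.inl j))
  let Y : Matrix (Fin 2) ({l // l ∈ T} ⊕ {v : V // v ≠ root}) ℤ :=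
    fun i j => G.matB root 1 (f (.inl i)) (f (.inr j))
  let E : Matrix {l // l ∈ T} {l // l ∈ T} ℤ := fun l l' => cornerForm (G.long l) (G.long l')
  let K := fromBlocks E (G.incMatrix root T) (-(G.incMatrix root T)ᵀ) 0
  have hKapply : ∀ i j, K i j = G.matB root (1 : ℤ) (f (.inr i)) (f (.inr j)) := by
    rintro (l | v) (l' | v')
    · exact (G.matB_one_vv root l l').symm
    · exact (G.matB_one_vp root l v').symm
    · rw [hskew]
      exact congrArg Neg.neg (G.matB_one_vp root l' v).symm
    · rfl
  have hM : (G.keptB root (1 : ℤ) {lt}ᶜ J₀).submatrix (Equiv.ofBijective _ hbij)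
      (Equiv.ofBijective _ hbij) = fromBlocks X Y (-Yᵀ) K := by
    ext (i | i) (j | j)
    · rfl
    · rfl
    · exact hskew _ _
    · exact (hKapply i j).symm
  obtain ⟨D, hCD, hDC⟩ := hT.exists_inverse root
  -- The differences of the potential across tree lines, and the vertex terms of
  -- `cornerForm_reduction`. The tree rows of the system hold by `potential_tree_line`, the
  -- hypermomentum rows by conservation at each vertex.
  let w : {l // l ∈ T} ⊕ {v : V // v ≠ root} → ℤ :=
    Sum.elim (fun l => F (G.tail l) - F (G.head l)) fun v => 2 * F (v, 0)
  have hw : ∀ i, (K *ᵥ w) i = Y 1 i := by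
    rintro (l | v)
    · have h1 := cornerForm_reduction hF hl₂ hroot (G.long l)
      rw [potential_tree_line hF hl₂ l.2] at h1
      have h2 : Y 1 (.inl l) = -cornerForm (G.long l) (G.long l₂) := by
        refine (hskew _ _).trans (congrArg Neg.neg ?_)
        exact G.matB_one_vv root l l₂
      have h3 : ∀ l', K (.inl l) (.inl l') = cornerForm (G.long l) (G.long l') := fun _ => rfl
      have h4 : ∀ v, K (.inl l) (.inr v) = ∑ i, G.long l (v, i) := fun _ => rfl
      rw [h2]
      simp only [mulVec, dotProduct, Fintype.sum_sum_type, h3, h4, w, Sum.elim_inl, Sum.elim_inr]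
      linarith
    · have h1 := inc_add_sum_eq_zero hF hl₂ v
      have h2 : Y 1 (.inr v) = G.inc l₂ v := G.matB_one_vp root l₂ v
      rw [h2]
      rw [← Finset.sum_coe_sort] at h1
      have h3 : ∀ l, K (.inr v) (.inl l) = -G.inc l v := fun _ => rfl
      have h4 : ∀ v', K (.inr v) (.inr v') = 0 := fun _ => rfl
      simp only [mulVec, dotProduct, Fintype.sum_sum_type, h3, h4, w, Sum.elim_inl, Sum.elim_inr,
        zero_mul, Finset.sum_const_zero, add_zero, neg_mul, Finset.sum_neg_distrib]
      simp only [mul_comm (G.inc _ _)]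
      linarith
  rw [← det_submatrix_equiv_self (Equiv.ofBijective _ hbij), hM,
    natAbs_det_fromBlocks_skew (X := X) (Y := Y) (K := K) (w := w) ?_ ?_
      (fromBlocks_bordered_mul hCD hDC) hw]
  · congr 2
    -- As `lt` is a loop line other than `l₂`, the potential agrees at an end of `lt` and at the
    -- next corner, whence the factor 2.
    have h1 := cornerForm_reduction hF hl₂ hroot (G.short lt)
    rw [sum_short_mul, potential_rot_of_loop hF hlt hne (Or.inl rfl),
      potential_rot_of_loop hF hlt hne (Or.inr rfl)] at h1
    have h2 : X 0 1 = cornerForm (G.short lt) (G.long l₂) :=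
      G.matB_one_uv root lt l₂
    have h3 : ∀ l : {l // l ∈ T}, Y 0 (.inl l) = cornerForm (G.short lt) (G.long l) := fun l =>
      G.matB_one_uv root lt l
    have h4 : ∀ v, Y 0 (.inr v) = ∑ i, G.short lt (v, i) := fun v =>
      G.matB_one_up root lt v
    simp only [mulVec, dotProduct, Fintype.sum_sum_type, h2, h3, h4, w, Sum.elim_inl, Sum.elim_inr]
    linarith
  · ext i j
    exact hskew _ _
  · ext i j
    rw [transpose_apply, Matrix.neg_apply, hKapply, hKapply]
    exact hskew _ _

end NCGraph

/-! ### Values of the Pfaffian, index counts, and covering of corners by loop lines. -/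

namespace NCGraph

variable {V L : Type*} [Fintype V] [DecidableEq V] [Fintype L] [DecidableEq L]

/-- The determinant is a rational square, hence nonnegative; no sign of the unimodular block has to
be tracked. -/
theorem nPf_sq_eq_natAbs (G : NCGraph V L) (root : V) (I J : Finset L) :
    G.nPf root I J ^ 2 = ((G.keptB root (1 : ℤ) I J).det.natAbs : ℚ) := by
  have h : G.nPf root I J ^ 2 = ((G.keptB root (1 : ℤ) I J).det : ℚ) := by
    rw [nPf_sq]
    refine Eq.trans (congrArg _ ?_) (RingHom.map_det (Int.castRingHom ℚ) _).symm
    ext ⟨(l | l | v), h⟩ ⟨(l' | l' | v'), h'⟩ <;> simp [matB]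
  have h0 : (0 : ℤ) ≤ (G.keptB root (1 : ℤ) I J).det := by
    have := sq_nonneg (G.nPf root I J)
    rw [h] at this
    exact_mod_cast this
  rw [h, ← Int.cast_natCast, Int.natAbs_of_nonneg h0]

theorem pos_ne {G : NCGraph V L} {T : Finset L} (hT : G.IsTreeOn T Finset.univ) (root : V)
    {l l' : L} (hne : l ≠ l') {h h' : V × Fin 4} (e : G.IsEnd l h) (e' : G.IsEnd l' h') :
    G.pos root T h ≠ G.pos root T h' := fun hp => by
  have := pos_injective hT root hp
  subst this
  exact hne (e.unique e')

theorem pos_head_ne_tail {G : NCGraph V L} {T : Finset L} (hT : G.IsTreeOn T Finset.univ) (root : V)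
    (l : L) : G.pos root T (G.head l) ≠ G.pos root T (G.tail l) := fun hp =>
  G.head_ne_tail l l (pos_injective hT root hp)

theorem ne_of_crosses_or_encompasses {G : NCGraph V L} {root : V} {T : Finset L} {a b : L}
    (h : G.Crosses root T a b ∨ G.Encompasses root T a b) : b ≠ a := by
  rintro rfl
  simp [Crosses, Encompasses] at h

theorem nPf_sq_of_crosses {G : NCGraph V L} (root : V) {T : Finset L} {lt l₂ : L} {J₀ : Finset L}
    (hJ : G.IsPseudoAdmissible T lt l₂ J₀) (hc : G.Crosses root T l₂ lt) :
    G.nPf root {lt}ᶜ J₀ ^ 2 = 4 := by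
  have hne := ne_of_crosses_or_encompasses (Or.inl hc)
  have hval : (2 * (G.potential root T l₂ (G.head lt) +
      G.potential root T l₂ (G.tail lt))).natAbs = 2 := by
    simp only [Crosses, start, finish] at hc
    unfold potential
    split_ifs <;> simp <;> omega
  rw [nPf_sq_eq_natAbs, natAbs_det_keptB root hJ hne, hval]
  norm_num

theorem nPf_sq_of_encompasses {G : NCGraph V L} (root : V) {T : Finset L} {lt l₂ : L}
    {J₀ : Finset L} (hJ : G.IsPseudoAdmissible T lt l₂ J₀) (hc : G.Encompasses root T l₂ lt) :
    G.nPf root {lt}ᶜ J₀ ^ 2 = 16 := by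
  have hne := ne_of_crosses_or_encompasses (Or.inr hc)
  have hval : (2 * (G.potential root T l₂ (G.head lt) +
      G.potential root T l₂ (G.tail lt))).natAbs = 4 := by
    simp only [Encompasses, start, finish] at hc
    unfold potential
    split_ifs <;> simp <;> omega
  rw [nPf_sq_eq_natAbs, natAbs_det_keptB root hJ hne, hval]
  norm_num

theorem exists_isEnd_start (G : NCGraph V L) (root : V) (T : Finset L) (l : L) :
    ∃ h, G.IsEnd l h ∧ G.pos root T h = G.start root T l := by
  rcases min_choice (G.pos root T (G.head l)) (G.pos root T (G.tail l)) with h | h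
  · exact ⟨_, Or.inl rfl, h.symm⟩
  · exact ⟨_, Or.inr rfl, h.symm⟩

theorem exists_isEnd_finish (G : NCGraph V L) (root : V) (T : Finset L) (l : L) :
    ∃ h, G.IsEnd l h ∧ G.pos root T h = G.finish root T l := by
  rcases max_choice (G.pos root T (G.head l)) (G.pos root T (G.tail l)) with h | h
  · exact ⟨_, Or.inl rfl, h.symm⟩
  · exact ⟨_, Or.inr rfl, h.symm⟩

theorem start_lt_finish {G : NCGraph V L} {T : Finset L} (hT : G.IsTreeOn T Finset.univ) (root : V)
    (l : L) : G.start root T l < G.finish root T l := by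
  have := pos_head_ne_tail hT root l
  unfold start finish
  omega

theorem IsEnd.pos_eq {G : NCGraph V L} {l : L} {h : V × Fin 4} (e : G.IsEnd l h) (root : V)
    (T : Finset L) : G.pos root T h = G.start root T l ∨ G.pos root T h = G.finish root T l := by
  unfold start finish
  rcases e with rfl | rfl <;> omega

theorem niceCrossing_of_lt {G : NCGraph V L} {root : V} {T : Finset L} {a b : L}
    (h1 : G.start root T a < G.start root T b) (h2 : G.start root T b < G.finish root T a)
    (h3 : G.finish root T a < G.finish root T b) {M : Finset L} (hM : ∀ m ∈ M, m = a ∨ m = b) :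
    G.NiceCrossing root T M a b := by
  refine ⟨?_, h2, ?_⟩
  · rintro rfl
    exact lt_irrefl _ h1
  · intro m hm h e
    have := e.pos_eq root T
    rcases hM m hm with rfl | rfl <;> omega

/-- With only two lines present, a crossing leaves nothing between the second start and the first
finish. If `l₂` encompasses `lt`, an end of `lt` always lies in the interval that should be empty.
-/
theorem isGenusLine_iff_crosses {G : NCGraph V L} {root : V} {T : Finset L} {lt l₂ : L}
    (hT : G.IsTreeOn T Finset.univ)
    (hc : G.Crosses root T l₂ lt ∨ G.Encompasses root T l₂ lt) :
    G.IsGenusLine root T {lt, l₂} lt ↔ G.Crosses root T l₂ lt := by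
  constructor
  · intro hg
    refine hc.resolve_right fun he => ?_
    obtain ⟨l', hl', hg⟩ := hg
    have hl₂ : l' = l₂ := by
      rcases Finset.mem_insert.1 hl' with rfl | h
      · rcases hg with hg | hg <;> exact absurd rfl hg.1
      · exact Finset.mem_singleton.1 h
    subst hl₂
    have hsf := start_lt_finish hT root lt
    unfold Encompasses at he
    rcases hg with ⟨_, _, h⟩ | ⟨_, _, h⟩
    · obtain ⟨k, hk, hp⟩ := G.exists_isEnd_start root T lt
      exact h lt (by simp) k hk (by omega)
    · obtain ⟨k, hk, hp⟩ := G.exists_isEnd_finish root T lt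
      exact h lt (by simp) k hk (by omega)
  · rintro (⟨h1, h2, h3⟩ | ⟨h1, h2, h3⟩)
    · exact ⟨l₂, by simp, Or.inr (niceCrossing_of_lt h1 h2 h3 (by simp [or_comm]))⟩
    · exact ⟨l₂, by simp, Or.inl (niceCrossing_of_lt h1 h2 h3 (by simp))⟩

theorem IsPseudoAdmissible.card {G : NCGraph V L} {T : Finset L} {lt l₂ : L} {J₀ : Finset L}
    (hJ : G.IsPseudoAdmissible T lt l₂ J₀) : J₀.card + Fintype.card V = Fintype.card L := by
  have h1 := Finset.card_add_card_compl J₀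
  have h2 := hJ.1.1
  rw [hJ.2.1, Finset.card_insert_of_notMem hJ.2.2.2] at h1
  rw [Finset.card_univ] at h2
  omega

theorem card_compl_singleton_cast (l : L) :
    (({l}ᶜ : Finset L).card : ℤ) = Fintype.card L - 1 := by
  have := Finset.card_add_card_compl ({l} : Finset L)
  rw [Finset.card_singleton] at this
  omega

theorem IsPseudoAdmissible.card_eq {G : NCGraph V L} {T : Finset L} {lt l₂ : L} {J₀ : Finset L}
    (hJ : G.IsPseudoAdmissible T lt l₂ J₀) : (J₀.card : ℤ) =
      (G.faces Finset.univ Finset.univ).card - 2 + G.twoGenus Finset.univ Finset.univ := by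
  have := hJ.card
  simp only [twoGenus, Finset.card_univ]
  omega

theorem IsPseudoAdmissible.twoGenus_sub_kIndex {G : NCGraph V L} {T : Finset L} {lt l₂ : L}
    {J₀ : Finset L} (hJ : G.IsPseudoAdmissible T lt l₂ J₀) :
    G.twoGenus Finset.univ Finset.univ - G.kIndex {lt}ᶜ J₀ = 2 := by
  have h1 := hJ.card_eq
  have h2 := card_compl_singleton_cast lt
  have h3 := hJ.card
  simp only [kIndex, h2, twoGenus, Finset.card_univ] at *
  omega

/-! ### Covering by loop lines -/

theorem mem_face (G : NCGraph V L) (S : Finset L) (h h' : V × Fin 4) :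
    h' ∈ G.face S h ↔ (G.faceStep S).SameCycle h h' := by
  simp [face]

theorem fst_mem_verts {G : NCGraph V L} {S : Finset L} {l : L} (hl : l ∈ S) {h : V × Fin 4}
    (e : G.IsEnd l h) : h.1 ∈ G.verts S := by
  rw [verts, Finset.mem_union, Finset.mem_image, Finset.mem_image]
  rcases e with rfl | rfl
  · exact Or.inl ⟨l, hl, rfl⟩
  · exact Or.inr ⟨l, hl, rfl⟩

theorem otherEnd_cases (G : NCGraph V L) (S : Finset L) (h : V × Fin 4) :
    ((∀ l ∈ S, ¬ G.IsEnd l h) ∧ G.otherEnd S h = h) ∨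
      ∃ l ∈ S, G.IsEnd l h ∧ G.IsEnd l (G.otherEnd S h) := by
  by_cases hS : ∃ l ∈ S, G.IsEnd l h
  · right
    obtain ⟨l, hl, e⟩ := hS
    refine ⟨l, hl, e, ?_⟩
    rcases e with rfl | rfl
    · rw [otherEnd_head G hl]; exact Or.inr rfl
    · rw [otherEnd_tail G hl]; exact Or.inl rfl
  · left
    push Not at hS
    exact ⟨hS, G.otherEnd_of_forall_not hS⟩

theorem faceStep_fst_mem_verts {G : NCGraph V L} {S : Finset L} {h : V × Fin 4}
    (hh : h.1 ∈ G.verts S) : (G.faceStep S h).1 ∈ G.verts S := by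
  rw [faceStep_apply]
  change (G.otherEnd S h).1 ∈ _
  rcases G.otherEnd_cases S h with ⟨_, e⟩ | ⟨l, hl, _, e⟩
  · rwa [e]
  · exact fst_mem_verts hl e

theorem fst_mem_verts_of_sameCycle {G : NCGraph V L} {S : Finset L} {h h' : V × Fin 4}
    (hh : h.1 ∈ G.verts S) (hs : (G.faceStep S).SameCycle h h') : h'.1 ∈ G.verts S := by
  have hpow : ∀ k : ℕ, ((G.faceStep S ^ k) h).1 ∈ G.verts S := fun k => by
    induction k with
    | zero => exact hh
    | succ k ih =>
      rw [pow_succ', Equiv.Perm.mul_apply]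
      exact faceStep_fst_mem_verts ih
  obtain ⟨k, _, rfl⟩ := hs.exists_pow_eq'
  exact hpow k

/-- A corner of `S` which no loop line of `S` covers in the rosette lies on the face of `S` that one
meets first. -/
theorem mem_face_of_not_covered {G : NCGraph V L} {root : V} {T S : Finset L}
    (hT : G.IsTreeOn T Finset.univ) (hTS : G.IsTreeOn (T ∩ S) (G.verts S)) {c h₀ : V × Fin 4}
    (hc : c.1 ∈ G.verts S) (hh₀ : h₀.1 ∈ G.verts S) (hcS : ∀ l ∈ S, l ∉ T → ¬ G.IsEnd l c)
    (hmin : ∀ h', h'.1 ∈ G.verts S → G.pos root T h₀ ≤ G.pos root T h')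
    (hcov : ∀ l ∈ S, l ∉ T → ¬ (G.start root T l < G.pos root T c ∧
      G.pos root T c < G.finish root T l)) : c ∈ G.face S h₀ := by
  let χ : V × Fin 4 → V × Fin 4 → ℤ := fun a h =>
    if G.pos root T a ≤ G.pos root T h then 1 else 0
  -- By minimality of `h₀`, this is the indicator of the stretch of the walk that begins at `h₀` and
  -- stops just before `c`.
  let F : V × Fin 4 → ℤ := fun h => χ h₀ h - χ c h
  have hF : ∀ h, F (G.faceStep T h) = F h +
      ((if G.faceStep T h = h₀ then 1 else 0) - (if G.faceStep T h = c then 1 else 0)) := by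
    intro h
    have key := indicator_le_cyclePos_apply (hT.exists_pow_faceStep (root, 0))
    have h1 := key h₀ h
    have h2 := key c h
    have h1' : χ h₀ (G.faceStep T h) = χ h₀ h + _ := h1
    have h2' : χ c (G.faceStep T h) = χ c h + _ := h2
    simp only [F]
    rw [h1', h2']
    ring
  have hrot : ∀ h, F (rot h) = F (G.otherEnd T h) +
      ((if rot h = h₀ then 1 else 0) - (if rot h = c then 1 else 0)) := by
    intro h
    have h1 := hF (G.otherEnd T h)
    rwa [faceStep_apply, G.otherEnd_involutive T h] at h1
  -- The differences of `F` across tree lines have the same sources as a unit flow inside `T ∩ S`.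
  -- By uniqueness of flows on the tree the two agree, so `F` is balanced on the tree lines outside
  -- `S`.
  obtain ⟨d, hd0, hd⟩ := exists_flow_of_reflTransGen (hTS.2.2 _ hh₀ _ hc)
  have hsumrot : ∀ (a : V × Fin 4) v,
      ∑ i, (if rot (v, i) = a then (1 : ℤ) else 0) = if a.1 = v then 1 else 0 := by
    intro a v
    rw [← sum_corner_ite a v]
    refine (Equiv.sum_comp (Equiv.addRight (1 : Fin 4))
      fun i => if (v, i) = a then (1 : ℤ) else 0).trans ?_
    simp only [eq_comm]
  have hflow : ∀ l ∈ T, (F (G.tail l) - F (G.head l)) - d l = 0 := by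
    refine hT.flow_eq_zero fun v => ?_
    have h1 := sum_rot_sub F v
    have h2 : ∀ i, F (rot (v, i)) - F (v, i) = ((if rot (v, i) = h₀ then (1 : ℤ) else 0) -
        (if rot (v, i) = c then 1 else 0)) +
        ∑ l ∈ T, (F (G.tail l) - F (G.head l)) * G.long l (v, i) := fun i => by
      rw [← sub_otherEnd_eq_sum, hrot]
      ring
    simp only [h2, Finset.sum_add_distrib, Finset.sum_sub_distrib, hsumrot] at h1
    rw [Finset.sum_comm] at h1
    simp only [← Finset.mul_sum] at h1
    have h3 : ∑ l ∈ T, d l * G.inc l v = ∑ l ∈ T ∩ S, d l * G.inc l v :=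
      (Finset.sum_subset Finset.inter_subset_left fun l _ hl => by rw [hd0 l hl, zero_mul]).symm
    simp only [sub_mul (_ - _) (d _), Finset.sum_sub_distrib]
    rw [h3, hd]
    change _ + ∑ l ∈ T, (F (G.tail l) - F (G.head l)) * G.inc l v = 0 at h1
    linarith
  have hbal : ∀ l ∈ T, l ∉ S → F (G.tail l) = F (G.head l) := fun l hl hlS => by
    have := hflow l hl
    rw [hd0 l (fun h => hlS (Finset.mem_inter.1 h).2)] at this
    linarith
  have hends : ∀ l, F (G.tail l) = F (G.head l) → ∀ h k, G.IsEnd l h → G.IsEnd l k → F h = F k := by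
    rintro l hl h k (rfl | rfl) (rfl | rfl)
    · rfl
    · exact hl.symm
    · exact hl
    · rfl
  -- Replacing `T` by `S` in the face walk does not affect `F`: common lines are followed in both,
  -- tree lines outside `S` are balanced, and so are loop lines of `S`, since none covers `c` and
  -- both of their ends come no earlier than `h₀`.
  have hS : ∀ h, h.1 ∈ G.verts S → F (G.otherEnd T (G.otherEnd S h)) = F h := by
    intro h hh
    rcases G.otherEnd_cases S h with ⟨hn, e⟩ | ⟨l, hl, e, e'⟩
    · rw [e]
      rcases G.otherEnd_cases T h with ⟨_, e1⟩ | ⟨l, hl, e1, e2⟩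
      · rw [e1]
      · exact hends l (hbal l hl fun hlS => hn l hlS e1) _ _ e2 e1
    · by_cases hlT : l ∈ T
      · congr 1
        rcases e with rfl | rfl
        · rw [otherEnd_head G hl, otherEnd_tail G hlT]
        · rw [otherEnd_tail G hl, otherEnd_head G hlT]
      · rw [otherEnd_of_notMem G hlT e']
        refine hends l ?_ _ _ e' e
        have h1 := hmin _ (fst_mem_verts hl (Or.inl rfl : G.IsEnd l (G.head l)))
        have h2 := hmin _ (fst_mem_verts hl (Or.inr rfl : G.IsEnd l (G.tail l)))
        have h3 := hcov l hl hlT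
        have h4 : G.pos root T c ≠ G.pos root T (G.head l) := fun hp =>
          hcS l hl hlT (Or.inl (pos_injective hT root hp))
        have h5 : G.pos root T c ≠ G.pos root T (G.tail l) := fun hp =>
          hcS l hl hlT (Or.inr (pos_injective hT root hp))
        simp only [start, finish] at h3
        simp only [F, χ, if_pos h1, if_pos h2]
        congr 1
        congr 1
        apply propext
        omega
  have hstep : ∀ h, h.1 ∈ G.verts S → F (G.faceStep S h) = F h +
      ((if G.faceStep S h = h₀ then 1 else 0) - (if G.faceStep S h = c then 1 else 0)) := by
    intro h hh
    rw [faceStep_apply, hrot, hS h hh]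
  have hmap : ∀ g : V × Fin 4 → ℤ,
      ∑ h ∈ G.face S c, g (G.faceStep S h) = ∑ h ∈ G.face S c, g h := by
    intro g
    refine Finset.sum_equiv (G.faceStep S) (fun h => ?_) fun _ _ => rfl
    rw [mem_face, mem_face, Equiv.Perm.sameCycle_apply_right]
  -- The total variation of `F` over the face of `c` is zero, so the loss at `c` must be compensated
  -- by the gain at `h₀` on the same face.
  have h1 := hmap F
  rw [Finset.sum_congr rfl fun h hh =>
    hstep h (fst_mem_verts_of_sameCycle hc ((G.mem_face S c h).1 hh)), Finset.sum_add_distrib,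
    add_eq_left, Finset.sum_sub_distrib, hmap fun h => if h = h₀ then 1 else 0,
    hmap fun h => if h = c then 1 else 0, Finset.sum_ite_eq', Finset.sum_ite_eq',
    if_pos ((G.mem_face S c c).2 (Equiv.Perm.SameCycle.refl _ _))] at h1
  have h2 : h₀ ∈ G.face S c := by
    by_contra hn
    simp [hn] at h1
  rw [mem_face] at h2 ⊢
  exact h2.symm

end NCGraph

/-! ### Power counting and convergence. -/

namespace NCGraph

open MeasureTheory

variable {V L : Type*} [Fintype V] [DecidableEq V] [Fintype L] [DecidableEq L]

theorem crosses_or_encompasses_of_covers {G : NCGraph V L} {root : V} {T : Finset L}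
    (hT : G.IsTreeOn T Finset.univ) {lt l₂ : L} (hne : lt ≠ l₂) {c : V × Fin 4} (e : G.IsEnd lt c)
    (h1 : G.start root T l₂ < G.pos root T c) (h2 : G.pos root T c < G.finish root T l₂) :
    G.Crosses root T l₂ lt ∨ G.Encompasses root T l₂ lt := by
  have n1 := pos_ne hT root hne (Or.inl rfl : G.IsEnd lt (G.head lt)) (Or.inl rfl)
  have n2 := pos_ne hT root hne (Or.inl rfl : G.IsEnd lt (G.head lt)) (Or.inr rfl)
  have n3 := pos_ne hT root hne (Or.inr rfl : G.IsEnd lt (G.tail lt)) (Or.inl rfl)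
  have n4 := pos_ne hT root hne (Or.inr rfl : G.IsEnd lt (G.tail lt)) (Or.inr rfl)
  simp only [Crosses, Encompasses, start, finish] at *
  rcases e with rfl | rfl <;> omega

/-- A line which breaks an internal face of `S` is covered by a loop line of `S`. -/
theorem BreaksInternalFaceAt.exists_cover {G : NCGraph V L} {root : V} {T S : Finset L} {lt : L}
    {c : V × Fin 4} (hb : G.BreaksInternalFaceAt root T S lt c) (hT : G.IsTreeOn T Finset.univ)
    (hTS : G.IsTreeOn (T ∩ S) (G.verts S)) :
    ∃ l₂ ∈ S, l₂ ∉ T ∧ G.start root T l₂ < G.pos root T c ∧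
      G.pos root T c < G.finish root T l₂ ∧
      (G.Crosses root T l₂ lt ∨ G.Encompasses root T l₂ lt) := by
  obtain ⟨hltS, e, hc, hext⟩ := hb
  by_contra! hno
  obtain ⟨h₀, hh₀, hmin⟩ := Finset.exists_min_image
    (Finset.univ.filter fun h : V × Fin 4 => h.1 ∈ G.verts S) (G.pos root T) ⟨c, by simpa using hc⟩
  have hmin' : ∀ h', h'.1 ∈ G.verts S → G.pos root T h₀ ≤ G.pos root T h' := fun h' hh' =>
    hmin h' (by simpa using hh')
  have hh₀' : h₀.1 ∈ G.verts S := by simpa using hh₀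
  refine hext ⟨h₀, hh₀', hmin', mem_face_of_not_covered hT hTS hc hh₀' ?_ hmin' ?_⟩
  · intro l hl _ e'
    exact hltS (e.unique e' ▸ hl)
  · rintro l hl hlT ⟨h1, h2⟩
    have hne : lt ≠ l := fun h => hltS (h ▸ hl)
    rcases crosses_or_encompasses_of_covers hT hne e h1 h2 with h | h
    · exact (hno l hl hlT h1 h2).1 h
    · exact (hno l hl hlT h1 h2).2 h

/-- The lines of `S` missing from `J₀` are `l₂` and a spanning tree of `S`, as many as `S` has
vertices. -/
theorem card_inter_add_card_verts {G : NCGraph V L} {T S : Finset L} {lt l₂ : L} {J₀ : Finset L}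
    (hTS : G.IsTreeOn (T ∩ S) (G.verts S)) (hl₂ : l₂ ∈ S) (hJ : G.IsPseudoAdmissible T lt l₂ J₀) :
    (J₀ ∩ S).card + (G.verts S).card = S.card := by
  have h1 := Finset.card_inter_add_card_sdiff S J₀
  have h2 : S \ J₀ = insert l₂ (T ∩ S) := by
    rw [Finset.sdiff_eq_inter_compl, hJ.2.1, Finset.inter_insert_of_mem hl₂, Finset.inter_comm]
  rw [h2, Finset.card_insert_of_notMem (fun h => hJ.2.2.2 (Finset.mem_inter.1 h).1), hTS.1,
    Finset.inter_comm] at h1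
  exact h1

/-- The number of lines of a subgraph with an external corner. -/
theorem two_mul_card_lt {G : NCGraph V L} {S : Finset L} {c : V × Fin 4} (hc : c.1 ∈ G.verts S)
    (hcS : ∀ l ∈ S, ¬ G.IsEnd l c) : 2 * S.card < 4 * (G.verts S).card := by
  have hdisj : Disjoint (S.image G.head) (S.image G.tail) := by
    rw [Finset.disjoint_left]
    intro h h1 h2
    obtain ⟨l, _, rfl⟩ := Finset.mem_image.1 h1
    obtain ⟨l', _, e⟩ := Finset.mem_image.1 h2
    exact G.head_ne_tail l l' e.symm
  have hcn : c ∉ S.image G.head ∪ S.image G.tail := by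
    intro h
    rcases Finset.mem_union.1 h with h | h <;> obtain ⟨l, hl, e⟩ := Finset.mem_image.1 h
    · exact hcS l hl (Or.inl e.symm)
    · exact hcS l hl (Or.inr e.symm)
  -- The ends of the lines of `S` and the free corner `c` are distinct corners of the vertices of
  -- `S`; `c` makes the inequality strict.
  have hsub : insert c (S.image G.head ∪ S.image G.tail) ⊆
      G.verts S ×ˢ (Finset.univ : Finset (Fin 4)) := by
    intro h hh
    simp only [Finset.mem_product, Finset.mem_univ, and_true]
    rcases Finset.mem_insert.1 hh with rfl | hh
    · exact hc
    · rcases Finset.mem_union.1 hh with h1 | h1 <;> obtain ⟨l, hl, rfl⟩ := Finset.mem_image.1 h1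
      · exact fst_mem_verts hl (Or.inl rfl)
      · exact fst_mem_verts hl (Or.inr rfl)
  have h1 := Finset.card_le_card hsub
  rw [Finset.card_insert_of_notMem hcn, Finset.card_union_of_disjoint hdisj,
    Finset.card_image_of_injective _ G.head_injective,
    Finset.card_image_of_injective _ G.tail_injective, Finset.card_product, Finset.card_univ,
    Fintype.card_fin] at h1
  omega

theorem rescale_pos {S : Finset L} {ρ : ℝ} (hρ : 0 < ρ) {t : L → ℝ} (ht : ∀ l, 0 < t l) (l : L) :
    0 < rescale S ρ t l := by
  unfold rescale
  have := ht l
  split_ifs <;> positivity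

theorem prod_rescale (S J : Finset L) (ρ : ℝ) (t : L → ℝ) :
    ∏ l ∈ J, rescale S ρ t l = ρ ^ (2 * (J ∩ S).card) * ∏ l ∈ J, t l := by
  have h : ∀ l, rescale S ρ t l = (if l ∈ S then ρ ^ 2 else 1) * t l := fun l => by
    unfold rescale
    split_ifs <;> simp
  simp only [h]
  rw [Finset.prod_mul_distrib, Finset.prod_ite_mem, Finset.prod_const, pow_mul]

/-- Every term of the expansion is a lower bound. -/
theorem term_le_HU (G : NCGraph V L) (root : V) {s : ℝ} (hs : 0 < s) {t : L → ℝ}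
    (ht : ∀ l, 0 < t l) (I J : Finset L) :
    s ^ (G.twoGenus Finset.univ Finset.univ - G.kIndex I J) * ((G.nPf root I J ^ 2 : ℚ) : ℝ) *
      (∏ l ∈ Iᶜ, t l) * ∏ l ∈ J, t l ≤ G.HU root s t := by
  have hnn : ∀ I J : Finset L, 0 ≤ s ^ (G.twoGenus Finset.univ Finset.univ - G.kIndex I J) *
      ((G.nPf root I J ^ 2 : ℚ) : ℝ) * (∏ l ∈ Iᶜ, t l) * ∏ l ∈ J, t l := fun I J => by
    have h1 : (0 : ℝ) ≤ ((G.nPf root I J ^ 2 : ℚ) : ℝ) := Rat.cast_nonneg.2 (sq_nonneg _)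
    have h2 : ∀ K : Finset L, 0 ≤ ∏ l ∈ K, t l := fun K => Finset.prod_nonneg fun l _ => (ht l).le
    have := h2 Iᶜ
    have := h2 J
    positivity
  rw [HU_eq_sum G root hs ht]
  refine le_trans ?_ (Finset.single_le_sum
    (f := fun I => ∑ J : Finset L, s ^ (G.twoGenus Finset.univ Finset.univ - G.kIndex I J) *
      ((G.nPf root I J ^ 2 : ℚ) : ℝ) * (∏ l ∈ Iᶜ, t l) * ∏ l ∈ J, t l)
    (fun I _ => Finset.sum_nonneg fun J _ => hnn I J) (Finset.mem_univ I))
  exact Finset.single_le_sum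
    (f := fun J => s ^ (G.twoGenus Finset.univ Finset.univ - G.kIndex I J) *
      ((G.nPf root I J ^ 2 : ℚ) : ℝ) * (∏ l ∈ Iᶜ, t l) * ∏ l ∈ J, t l)
    (fun J _ => hnn I J) (Finset.mem_univ J)

/-- The power counting bound. -/
theorem le_HU_rescale {G : NCGraph V L} (root : V) {s : ℝ} (hs : 0 < s) {T S : Finset L}
    {lt l₂ : L} {J₀ : Finset L} (hltS : lt ∉ S) (hTS : G.IsTreeOn (T ∩ S) (G.verts S))
    (hl₂ : l₂ ∈ S) (hJ : G.IsPseudoAdmissible T lt l₂ J₀) {t : L → ℝ} (ht : ∀ l, 0 < t l) {ρ : ℝ}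
    (hρ : 0 < ρ) :
    s ^ 2 * ((G.nPf root {lt}ᶜ J₀ ^ 2 : ℚ) : ℝ) * (t lt * ∏ l ∈ J₀, t l) *
      ρ ^ (2 * (S.card - (G.verts S).card)) ≤ G.HU root s (rescale S ρ t) := by
  refine le_trans (le_of_eq ?_) (term_le_HU G root hs (rescale_pos hρ ht) {lt}ᶜ J₀)
  have h1 := card_inter_add_card_verts hTS hl₂ hJ
  rw [hJ.twoGenus_sub_kIndex, compl_compl, Finset.prod_singleton, prod_rescale,
    show S.card - (G.verts S).card = (J₀ ∩ S).card by omega, rescale, if_neg hltS]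
  norm_cast
  ring

/-- The expansion is polynomial in `ρ`, whereas the definition of `HU` contains inverses of the
parameters. -/
theorem continuousOn_HU_rescale (G : NCGraph V L) (root : V) {s : ℝ} (hs : 0 < s) (S : Finset L)
    {t : L → ℝ} (ht : ∀ l, 0 < t l) :
    ContinuousOn (fun ρ : ℝ => G.HU root s (rescale S ρ t)) (Set.Ioc 0 1) := by
  refine ContinuousOn.congr (f := fun ρ => ∑ I : Finset L, ∑ J : Finset L,
      s ^ (G.twoGenus Finset.univ Finset.univ - G.kIndex I J) * ((G.nPf root I J ^ 2 : ℚ) : ℝ) *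
        (∏ l ∈ Iᶜ, rescale S ρ t l) * ∏ l ∈ J, rescale S ρ t l) ?_
    fun ρ hρ => HU_eq_sum G root hs (rescale_pos hρ.1 ht)
  simp only [prod_rescale]
  fun_prop

/-- A power of a function which is bounded below by a small enough power is integrable. -/
theorem integrableOn_pow_mul_cpow {f : ℝ → ℝ} (hf : ContinuousOn f (Set.Ioc 0 1)) {C : ℝ}
    (hC : 0 < C) {a N : ℕ} (hN : 0 < N) (hle : ∀ ρ ∈ Set.Ioc (0 : ℝ) 1, C * ρ ^ (2 * a) ≤ f ρ)
    {D : ℂ} (hD : 0 < D.re) (ha : a * D.re < N) :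
    IntegrableOn (fun ρ : ℝ => ((ρ ^ (N - 1) : ℝ) : ℂ) * ((f ρ : ℝ) : ℂ) ^ (-(D / 2)))
      (Set.Ioc 0 1) := by
  have hpos : ∀ ρ ∈ Set.Ioc (0 : ℝ) 1, 0 < f ρ := fun ρ hρ =>
    lt_of_lt_of_le (mul_pos hC (pow_pos hρ.1 _)) (hle ρ hρ)
  have hre : (-(D / 2)).re = -(D.re / 2) := by simp
  have hmeas : ContinuousOn (fun ρ : ℝ => ((ρ ^ (N - 1) : ℝ) : ℂ) * ((f ρ : ℝ) : ℂ) ^ (-(D / 2)))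
      (Set.Ioc 0 1) := by
    refine ContinuousOn.mul (by fun_prop) (ContinuousOn.cpow
      (Complex.continuous_ofReal.comp_continuousOn hf) continuousOn_const fun ρ hρ => ?_)
    exact Complex.ofReal_mem_slitPlane.2 (hpos ρ hρ)
  -- The dominating power is integrable at 0 because its exponent exceeds -1, which is exactly `ha`.
  have hint : IntegrableOn (fun ρ : ℝ => C ^ (-(D.re / 2)) * ρ ^ ((N : ℝ) - 1 - a * D.re))
      (Set.Ioc 0 1) := by
    have h1 := intervalIntegral.intervalIntegrable_rpow' (a := 0) (b := 1)
      (r := (N : ℝ) - 1 - a * D.re) (by linarith)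
    rw [intervalIntegrable_iff_integrableOn_Ioc_of_le zero_le_one] at h1
    exact h1.const_mul _
  refine Integrable.mono' hint (hmeas.aestronglyMeasurable measurableSet_Ioc) ?_
  rw [ae_restrict_iff' measurableSet_Ioc]
  refine Filter.Eventually.of_forall fun ρ hρ => ?_
  have hρ0 := hρ.1
  have hb : f ρ ^ (-(D.re / 2)) ≤ C ^ (-(D.re / 2)) * ρ ^ (-(a * D.re)) := by
    refine (Real.rpow_le_rpow_of_nonpos (mul_pos hC (pow_pos hρ0 (2 * a))) (hle ρ hρ)
      (by linarith)).trans (le_of_eq ?_)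
    rw [Real.mul_rpow hC.le (pow_nonneg hρ0.le _), ← Real.rpow_natCast, ← Real.rpow_mul hρ0.le]
    congr 2
    push_cast
    ring
  rw [norm_mul, Complex.norm_real, Complex.norm_cpow_eq_rpow_re_of_pos (hpos ρ hρ), hre,
    Real.norm_of_nonneg (pow_nonneg hρ0.le _)]
  have hpow : ρ ^ (N - 1) = ρ ^ ((N : ℝ) - 1) := by
    rw [← Real.rpow_natCast, Nat.cast_pred hN]
  calc ρ ^ (N - 1) * f ρ ^ (-(D.re / 2))
      ≤ ρ ^ (N - 1) * (C ^ (-(D.re / 2)) * ρ ^ (-(a * D.re))) :=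
        mul_le_mul_of_nonneg_left hb (pow_nonneg hρ0.le _)
    _ = C ^ (-(D.re / 2)) * ρ ^ ((N : ℝ) - 1 - a * D.re) := by
        rw [hpow, sub_eq_add_neg ((N : ℝ) - 1), Real.rpow_add hρ0]
        ring

/-- A subgraph with an internal face broken by a line of the graph is convergent in dimension
slightly above four. -/
theorem BreaksInternalFaceAt.exists_integrableOn {G : NCGraph V L} {root : V} {s : ℝ} (hs : 0 < s)
    {T S : Finset L} {lt : L} {c : V × Fin 4} (hb : G.BreaksInternalFaceAt root T S lt c)
    (hT : G.IsTreeOn T Finset.univ) (hTS : G.IsTreeOn (T ∩ S) (G.verts S)) (hlt : lt ∉ T) :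
    ∃ δ : ℝ, 0 < δ ∧ ∀ t : L → ℝ, (∀ l, 0 < t l) → ∀ D : ℂ, 0 < D.re → D.re < 4 + δ →
      IntegrableOn
        (fun ρ : ℝ => ((ρ ^ (2 * S.card - 1) : ℝ) : ℂ) *
          ((G.HU root s (rescale S ρ t) : ℝ) : ℂ) ^ (-(D / 2)))
        (Set.Ioc 0 1) := by
  obtain ⟨l₂, hl₂, hl₂T, _, _, hce⟩ := hb.exists_cover hT hTS
  obtain ⟨hltS, e, hc, _⟩ := hb
  have hJ : G.IsPseudoAdmissible T lt l₂ (insert l₂ T)ᶜ := ⟨hT, compl_compl _, hlt, hl₂T⟩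
  have hcard := card_inter_add_card_verts hTS hl₂ hJ
  have hgap := two_mul_card_lt hc fun l hl e' => hltS (e.unique e' ▸ hl)
  set J₀ : Finset L := (insert l₂ T)ᶜ
  set a : ℕ := S.card - (G.verts S).card with ha
  have haS : (a : ℝ) + (G.verts S).card = S.card := by
    have : a + (G.verts S).card = S.card := by omega
    exact_mod_cast this
  have hgap' : (0 : ℝ) < 4 * (G.verts S).card - 2 * S.card := by
    have : (2 * S.card : ℝ) < 4 * (G.verts S).card := by exact_mod_cast hgap
    linarith
  have ha1 : (0 : ℝ) < a + 1 := by positivity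
  have hn : (0 : ℝ) < ((G.nPf root {lt}ᶜ J₀ ^ 2 : ℚ) : ℝ) := by
    rcases hce with h | h
    · rw [nPf_sq_of_crosses root hJ h]; norm_num
    · rw [nPf_sq_of_encompasses root hJ h]; norm_num
  -- With `a = L(S) - n(S)`, convergence needs `a * Re D < 2 L(S) = 4 a + (4 n(S) - 2 L(S))`.
  -- Dividing the gap by `a + 1` rather than `a` keeps the inequality strict and allows `a = 0`.
  refine ⟨(4 * (G.verts S).card - 2 * S.card) / (a + 1), div_pos hgap' ha1, fun t ht D hD hD4 => ?_⟩
  have hS : 0 < S.card := Finset.card_pos.2 ⟨l₂, hl₂⟩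
  have hC : 0 < s ^ 2 * ((G.nPf root {lt}ᶜ J₀ ^ 2 : ℚ) : ℝ) * (t lt * ∏ l ∈ J₀, t l) :=
    mul_pos (mul_pos (pow_pos hs 2) hn) (mul_pos (ht lt) (Finset.prod_pos fun l _ => ht l))
  refine integrableOn_pow_mul_cpow (a := a) (continuousOn_HU_rescale G root hs S ht) hC (by omega)
    (fun ρ hρ => le_HU_rescale root hs hltS hTS hl₂ hJ ht hρ.1) hD ?_
  have h1 : (a : ℝ) * D.re ≤
      a * (4 + (4 * (G.verts S).card - 2 * S.card) / (a + 1)) :=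
    mul_le_mul_of_nonneg_left hD4.le (Nat.cast_nonneg a)
  have h2 : (a : ℝ) * ((4 * (G.verts S).card - 2 * S.card) / (a + 1)) <
      4 * (G.verts S).card - 2 * S.card := by
    rw [mul_div_assoc', div_lt_iff₀ ha1]
    linarith
  push_cast
  linarith

end NCGraph

theorem mainTheorem8 {V L : Type*} [Fintype V] [DecidableEq V] [Fintype L] [DecidableEq L]
    (G : NCGraph V L) (root : V) (s : ℝ) (hs : 0 < s) :
    -- the expansion of `HU` in which the terms below occur
    (∀ t : L → ℝ, (∀ l, 0 < t l) →
      G.HU root s t = ∑ I : Finset L, ∑ J : Finset L,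
        s ^ (G.twoGenus Finset.univ Finset.univ - G.kIndex I J) * ((G.nPf root I J ^ 2 : ℚ) : ℝ) *
          (∏ l ∈ Iᶜ, t l) * ∏ l ∈ J, t l) ∧
    -- the value of the Pfaffian
    (∀ (T : Finset L) (lt l₂ : L) (J₀ : Finset L), G.IsPseudoAdmissible T lt l₂ J₀ →
      (G.Crosses root T l₂ lt ∨ G.Encompasses root T l₂ lt) →
      (G.IsGenusLine root T {lt, l₂} lt ↔ G.Crosses root T l₂ lt) ∧
      (G.IsGenusLine root T {lt, l₂} lt → G.nPf root {lt}ᶜ J₀ ^ 2 = 4) ∧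
      (¬ G.IsGenusLine root T {lt, l₂} lt → G.nPf root {lt}ᶜ J₀ ^ 2 = 16) ∧
      (({lt}ᶜ : Finset L).card : ℤ) = Fintype.card L - 1 ∧
      (J₀.card : ℤ) = (G.faces Finset.univ Finset.univ).card - 2
        + G.twoGenus Finset.univ Finset.univ ∧
      G.twoGenus Finset.univ Finset.univ - G.kIndex {lt}ᶜ J₀ = 2) ∧
    -- planar subgraphs with more than one broken face are convergent
    (∀ (T S : Finset L) (lt : L) (c : V × Fin 4),
      G.IsTreeOn T Finset.univ → G.IsTreeOn (T ∩ S) (G.verts S) → lt ∉ T →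
      G.twoGenus (G.verts S) S = 0 → 1 < (G.brokenFaces (G.verts S) S).card →
      G.BreaksInternalFaceAt root T S lt c →
      (∃ l₂ ∈ S, l₂ ∉ T ∧ G.start root T l₂ < G.pos root T c ∧
        G.pos root T c < G.finish root T l₂ ∧
        (G.Crosses root T l₂ lt ∨ G.Encompasses root T l₂ lt)) ∧
      (∀ l₂ ∈ S, ∀ J₀ : Finset L, G.IsPseudoAdmissible T lt l₂ J₀ →
        (G.Crosses root T l₂ lt ∨ G.Encompasses root T l₂ lt) →
        (J₀ ∩ S).card + (G.verts S).card = S.card ∧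
        ∀ t : L → ℝ, (∀ l, 0 < t l) → ∀ ρ : ℝ, 0 < ρ →
          s ^ 2 * ((G.nPf root {lt}ᶜ J₀ ^ 2 : ℚ) : ℝ) * (t lt * ∏ l ∈ J₀, t l) *
            ρ ^ (2 * (S.card - (G.verts S).card)) ≤ G.HU root s (NCGraph.rescale S ρ t)) ∧
      ∃ δ : ℝ, 0 < δ ∧ ∀ t : L → ℝ, (∀ l, 0 < t l) → ∀ D : ℂ, 0 < D.re → D.re < 4 + δ →
        MeasureTheory.IntegrableOn
          (fun ρ : ℝ => ((ρ ^ (2 * S.card - 1) : ℝ) : ℂ) *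
            ((G.HU root s (NCGraph.rescale S ρ t) : ℝ) : ℂ) ^ (-(D / 2)))
          (Set.Ioc 0 1)) := by
  refine ⟨fun t ht => G.HU_eq_sum root hs ht, ?_, ?_⟩
  · intro T lt l₂ J₀ hJ hc
    refine ⟨NCGraph.isGenusLine_iff_crosses hJ.1 hc, fun hg => ?_, fun hg => ?_,
      NCGraph.card_compl_singleton_cast lt, hJ.card_eq, hJ.twoGenus_sub_kIndex⟩
    · exact NCGraph.nPf_sq_of_crosses root hJ ((NCGraph.isGenusLine_iff_crosses hJ.1 hc).1 hg)
    · exact NCGraph.nPf_sq_of_encompasses root hJ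
        (hc.resolve_left fun h => hg ((NCGraph.isGenusLine_iff_crosses hJ.1 hc).2 h))
  · intro T S lt c hT hTS hlt _ _ hb
    refine ⟨hb.exists_cover hT hTS, fun l₂ hl₂ J₀ hJ _ => ?_, hb.exists_integrableOn hs hT hTS hlt⟩
    exact ⟨NCGraph.card_inter_add_card_verts hTS hl₂ hJ, fun t ht ρ hρ =>
      NCGraph.le_HU_rescale root hs hb.1 hTS hl₂ hJ ht hρ⟩
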